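/- Let $k\ge 1$ be an integer and let $$\mathcal H_k=\langle x,y,z \mid [x,y]=z,\ [x,z]=1,\ [y,z]=1,\ z^k=1\rangle ,\qquad [a,b]=aba^{-1}b^{-1},$$ be the quotient of the integral Heisenberg group $H_3(\mathbb Z)=\langle x,y,z\mid [x,y]=z,\ [x,z]=[y,z]=1\rangle$ by the central subgroup $\langle z^k\rangle$. The group homology and cohomology of $\mathcal H_k$ with coefficients in the trivial module $\mathbb Z$ are, up to isomorphism of abelian groups, $$ H_i(\mathcal H_k,\mathbb Z)\cong\begin{cases} \mathbb Z & i=0,\\ \mathbb Z^2 & i=1,\\ (\mathbb Z/k)^2\oplus\mathbb Z & i=2,\\ \mathbb Z/k^2 & i>1 \text{ odd},\\ (\mathbb Z/k)^2 & i>2 \text{ even}, \end{cases} \qquad H^i(\mathcal H_k,\mathbb Z)\cong\begin{cases} \mathbb Z & i=0,\\ \mathbb Z^2 & i=1,\\ \mathbb Z & i=2,\\ (\mathbb Z/k)^2 & i>1 \text{ odd},\\ \mathbb Z/k^2 & i>2 \text{ even}. \end{cases} $$ Here $\mathbb Z/k^2$ is the cyclic group of order $k^2$. -/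

import Mathlib

/-- The three generators `x`, `y`, `z` of the Heisenberg group. -/
inductive HeisenbergGen : Type
  | x
  | y
  | z

namespace HeisenbergGen

/-- The words `[x,y] z⁻¹`, `[x,z]`, `[y,z]`, `z ^ k` in the free group on `x`, `y`, `z`,
where `[a,b] = a b a⁻¹ b⁻¹`. -/
def relators (k : ℕ) : Set (FreeGroup HeisenbergGen) :=
  let X := FreeGroup.of HeisenbergGen.x
  let Y := FreeGroup.of HeisenbergGen.y
  let Z := FreeGroup.of HeisenbergGen.z
  {X * Y * X⁻¹ * Y⁻¹ * Z⁻¹, X * Z * X⁻¹ * Z⁻¹, Y * Z * Y⁻¹ * Z⁻¹, Z ^ k}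

end HeisenbergGen

/-- The central quotient of the integral Heisenberg group,
`⟨x, y, z ∣ [x,y] = z, [x,z] = 1, [y,z] = 1, z ^ k = 1⟩`. -/
abbrev HeisenbergQuotient (k : ℕ) : Type :=
  PresentedGroup (HeisenbergGen.relators k)

/-! The group is a central extension of `ℤ²` by the cyclic group generated by `z`, which has order
exactly `k`. A free resolution of `ℤ` over the group ring is built from the 2-periodic resolution of
the centre (differentials alternately `z - 1` and the norm `N`) and the Koszul resolution of `ℤ²`,
in Wall's manner. The horizontal maps are lifted by the Fox derivatives of `[x,y]`, namely `1 - zy`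
and `x - z`. Their composite with `(x - 1, y - 1)` is not zero but `z - 1` (`fox_identity`). Since
`z - 1` is a vertical differential, a second-order term, `-1` or `0` according to parity, cancels it
(`perturbation_identity`). The ranks are 1, 3, 4, 4, ….

Exactness (`exists_of_vecMul_boundary_eq_zero`) is a staircase argument with two inputs. In the
group ring, the annihilators of `N` and of `z - 1` are generated by `z - 1` and `N`
(`exists_of_mul_N_eq_zero`, `exists_of_mul_Z_sub_one_eq_zero`). Modulo `z - 1`, the ring is the
Laurent polynomial ring of `ℤ²`, a domain in which the Koszul complex is exact (`exists_koszul`).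

The augmentation sends `N` to `k` and every other nonconstant entry to 0. From degree 2 on, the
integral differentials are alternately `-k` on the two middle coordinates, which yields `(ℤ/k)²`,
and the block with rows `(k, 0)`, `(-1, k)` on the outer two. The entry `-1` makes the cokernel of
this block cyclic of order `k²` instead of `(ℤ/k)²`. Transposing moves the cyclic groups from odd
homology to even cohomology. -/

namespace HeisenbergQuotient

/-! ### Structure of the group: the central extension and the order of `z`. -/

variable {k : ℕ}

/-- The generator `x` of the central quotient of the Heisenberg group. -/
def x : HeisenbergQuotient k := PresentedGroup.of HeisenbergGen.x

/-- The generator `y` of the central quotient of the Heisenberg group. -/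
def y : HeisenbergQuotient k := PresentedGroup.of HeisenbergGen.y

/-- The generator `z` of the central quotient of the Heisenberg group. -/
def z : HeisenbergQuotient k := PresentedGroup.of HeisenbergGen.z

theorem x_mul_y : (x * y : HeisenbergQuotient k) = z * (y * x) := by
  have h : (x * y * x⁻¹ * y⁻¹ * z⁻¹ : HeisenbergQuotient k) = 1 :=
    PresentedGroup.one_of_mem (rels := HeisenbergGen.relators k) (by simp [HeisenbergGen.relators])
  rw [mul_inv_eq_one, mul_inv_eq_iff_eq_mul, mul_inv_eq_iff_eq_mul, mul_assoc] at h
  exact h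

theorem x_mul_z : (x * z : HeisenbergQuotient k) = z * x := by
  have h : (x * z * x⁻¹ * z⁻¹ : HeisenbergQuotient k) = 1 :=
    PresentedGroup.one_of_mem (rels := HeisenbergGen.relators k) (by simp [HeisenbergGen.relators])
  rwa [mul_inv_eq_one, mul_inv_eq_iff_eq_mul] at h

theorem y_mul_z : (y * z : HeisenbergQuotient k) = z * y := by
  have h : (y * z * y⁻¹ * z⁻¹ : HeisenbergQuotient k) = 1 :=
    PresentedGroup.one_of_mem (rels := HeisenbergGen.relators k) (by simp [HeisenbergGen.relators])
  rwa [mul_inv_eq_one, mul_inv_eq_iff_eq_mul] at h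

theorem z_pow : (z : HeisenbergQuotient k) ^ k = 1 :=
  PresentedGroup.one_of_mem (rels := HeisenbergGen.relators k) (by simp [HeisenbergGen.relators])

theorem eq_top_of_mem {H : Subgroup (HeisenbergQuotient k)} (hx : x ∈ H) (hy : y ∈ H)
    (hz : z ∈ H) : H = ⊤ := by
  rw [eq_top_iff, ← PresentedGroup.closure_range_of, Subgroup.closure_le]
  rintro _ ⟨_ | _ | _, rfl⟩ <;> assumption

theorem z_mem_center : (z : HeisenbergQuotient k) ∈ Subgroup.center (HeisenbergQuotient k) := by
  have h : Subgroup.centralizer {(z : HeisenbergQuotient k)} = ⊤ :=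
    eq_top_of_mem (by simp [Subgroup.mem_centralizer_singleton_iff, x_mul_z])
      (by simp [Subgroup.mem_centralizer_singleton_iff, y_mul_z])
      (by simp [Subgroup.mem_centralizer_singleton_iff])
  rw [Subgroup.mem_center_iff]
  intro g
  have hg : g ∈ Subgroup.centralizer {(z : HeisenbergQuotient k)} := h ▸ Subgroup.mem_top g
  exact Subgroup.mem_centralizer_singleton_iff.1 hg

/-- The free abelian group of rank two, written multiplicatively. -/
abbrev Plane : Type := Multiplicative ℤ × Multiplicative ℤ

/-- The projection of the central quotient of the Heisenberg group to its abelianization. -/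
def toPlane : HeisenbergQuotient k →* Plane :=
  PresentedGroup.toGroup (rels := HeisenbergGen.relators k)
    (f := fun g => HeisenbergGen.casesOn g (Multiplicative.ofAdd 1, 1) (1, Multiplicative.ofAdd 1) 1)
    (by
      rintro r (rfl | rfl | rfl | rfl) <;> simp)

@[simp] theorem toPlane_x : toPlane (x : HeisenbergQuotient k) = (Multiplicative.ofAdd 1, 1) :=
  PresentedGroup.toGroup.of _

@[simp] theorem toPlane_y : toPlane (y : HeisenbergQuotient k) = (1, Multiplicative.ofAdd 1) :=
  PresentedGroup.toGroup.of _

@[simp] theorem toPlane_z : toPlane (z : HeisenbergQuotient k) = 1 :=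
  PresentedGroup.toGroup.of _

/-- The set-theoretic section `(i, j) ↦ x ^ i * y ^ j` of `toPlane`. -/
def ofPlane (q : Plane) : HeisenbergQuotient k :=
  x ^ (Multiplicative.toAdd q.1) * y ^ (Multiplicative.toAdd q.2)

@[simp] theorem toPlane_ofPlane (q : Plane) :
    toPlane (ofPlane q : HeisenbergQuotient k) = q := by
  ext <;> simp [ofPlane, ← ofAdd_zsmul]

theorem ofPlane_injective : Function.Injective (ofPlane : Plane → HeisenbergQuotient k) :=
  Function.LeftInverse.injective toPlane_ofPlane

/-- Modulo the central subgroup generated by `z` the images of `x` and `y` commute, so the quotient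
map factors through `toPlane`. Only existence of `m` is needed. -/
theorem exists_eq_ofPlane_mul_zpow (g : HeisenbergQuotient k) :
    ∃ m : ℤ, g = ofPlane (toPlane g) * z ^ m := by
  let C : Subgroup (HeisenbergQuotient k) := Subgroup.zpowers z
  have hC : C.Normal := by
    refine ⟨fun n hn g => ?_⟩
    have hc : n ∈ Subgroup.center (HeisenbergQuotient k) :=
      Subgroup.zpowers_le.2 z_mem_center hn
    rwa [Subgroup.mem_center_iff.1 hc g, mul_inv_cancel_right]
  let p := QuotientGroup.mk' C
  have hpz : p z = 1 := (QuotientGroup.eq_one_iff _).2 (Subgroup.mem_zpowers z)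
  have hcomm : Commute (p x) (p y) := by
    rw [commute_iff_eq, ← map_mul, ← map_mul, x_mul_y, map_mul, hpz, one_mul]
  -- The factorization of the quotient map through `Plane`; it exists because the images of `x` and
  -- `y` commute.
  let φ : Plane →* HeisenbergQuotient k ⧸ C :=
    MonoidHom.noncommCoprod (zpowersHom _ (p x)) (zpowersHom _ (p y))
      (fun m n => by simpa [zpowersHom_apply] using hcomm.zpow_zpow _ _)
  have h : φ.comp toPlane = p := by
    refine PresentedGroup.ext ?_
    rintro (_ | _ | _)
    · change φ (toPlane x) = p x
      simp [φ]
    · change φ (toPlane y) = p y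
      simp [φ]
    · change φ (toPlane z) = p z
      simp [hpz]
  have hg : p (ofPlane (toPlane g)) = p g := by
    rw [← h]
    simp [φ, ofPlane, zpowersHom_apply]
  obtain ⟨m, hm⟩ := Subgroup.mem_zpowers_iff.1 (QuotientGroup.eq.1 hg)
  exact ⟨m, by rw [hm, mul_inv_cancel_left]⟩

/-- The permutation representation of the Heisenberg group on `(ZMod k)²` in which `z` is the
translation of the second coordinate. -/
def toPerm : HeisenbergQuotient k →* Equiv.Perm (ZMod k × ZMod k) :=
  PresentedGroup.toGroup (rels := HeisenbergGen.relators k)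
    (f := fun g => HeisenbergGen.casesOn g
      (Equiv.prodShear (Equiv.refl _) Equiv.addRight)
      (Equiv.prodCongr (Equiv.addRight 1) (Equiv.refl _))
      (Equiv.prodCongr (Equiv.refl _) (Equiv.addRight 1)))
    (by
      have key (n : ℕ) (v : ZMod k × ZMod k) :
          ((Equiv.prodCongr (Equiv.refl _) (Equiv.addRight 1) : Equiv.Perm (ZMod k × ZMod k)) ^ n) v
            = (v.1, v.2 + n) := by
        induction n with
        | zero => simp
        | succ n ih => rw [pow_succ', Equiv.Perm.mul_apply, ih]; ext <;> simp [add_assoc]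
      rintro r (rfl | rfl | rfl | rfl)
      · simp only [map_mul, map_inv, FreeGroup.lift_apply_of, mul_inv_eq_iff_eq_mul]
        ext v
        · simp
        · simp; ring
      · simp only [map_mul, map_inv, FreeGroup.lift_apply_of, mul_inv_eq_iff_eq_mul]
        ext v
        · simp
        · simp; ring
      · simp only [map_mul, map_inv, FreeGroup.lift_apply_of, mul_inv_eq_iff_eq_mul]
        ext v <;> simp
      · ext v <;> simp [key])

theorem toPerm_z_pow (n : ℕ) (v : ZMod k × ZMod k) :
    toPerm ((z : HeisenbergQuotient k) ^ n) v = (v.1, v.2 + n) := by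
  induction n with
  | zero => simp
  | succ n ih =>
    have hz (w : ZMod k × ZMod k) : toPerm (z : HeisenbergQuotient k) w = (w.1, w.2 + 1) := by
      rw [toPerm, z, PresentedGroup.toGroup.of]
      rfl
    rw [pow_succ', map_mul, Equiv.Perm.mul_apply, ih, hz]
    ext <;> simp [add_assoc]

/-- The presentation alone does not show that `z` has no smaller order; the permutation
representation detects it, since `z ^ n` moves the origin to `(0, n)`. -/
theorem dvd_of_z_pow_eq_one {n : ℕ} (h : (z : HeisenbergQuotient k) ^ n = 1) : k ∣ n := by
  have := congrArg Prod.snd (toPerm_z_pow (k := k) n 0)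
  rw [h] at this
  simpa [eq_comm, ZMod.natCast_eq_zero_iff] using this

end HeisenbergQuotient

/-! ### Left ideals of a group ring and its augmentation. -/

namespace MonoidAlgebra

variable {G H : Type*} [Group G]

/-- The group elements congruent to `1` modulo a left ideal of the group ring. -/
def subgroupOfIdeal (I : Ideal (MonoidAlgebra ℤ G)) : Subgroup G where
  carrier := {g | of ℤ G g - 1 ∈ I}
  one_mem' := by simp [one_def]
  mul_mem' {g h} hg hh := by
    have : of ℤ G (g * h) - 1 = of ℤ G g * (of ℤ G h - 1) + (of ℤ G g - 1) := by
      rw [map_mul]; noncomm_ring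
    rw [Set.mem_ofPred_eq, this]
    exact I.add_mem (I.mul_mem_left _ hh) hg
  inv_mem' {g} hg := by
    have : of ℤ G g⁻¹ - 1 = -(of ℤ G g⁻¹ * (of ℤ G g - 1)) := by
      rw [mul_sub, ← map_mul, inv_mul_cancel, map_one]; noncomm_ring
    rw [Set.mem_ofPred_eq, this]
    exact I.neg_mem (I.mul_mem_left _ hg)

/-- By linearity it suffices to test group elements. Neither map need be multiplicative, so the
set-theoretic section `ofPlane` is allowed as `s`. -/
theorem sub_mapDomain_mem {I : Ideal (MonoidAlgebra ℤ G)} (f : G → H) (s : H → G)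
    (h : ∀ g, of ℤ G g - of ℤ G (s (f g)) ∈ I) (r : MonoidAlgebra ℤ G) :
    r - mapDomain s (mapDomain f r) ∈ I := by
  induction r using induction_linear with
  | zero => simp
  | add a b ha hb =>
    rw [mapDomain_add, mapDomain_add, add_sub_add_comm]
    exact I.add_mem ha hb
  | single g n =>
    have : single g n - mapDomain s (mapDomain f (single g n)) =
        n • (of ℤ G g - of ℤ G (s (f g))) := by
      simp [smul_sub, smul_single]
    rw [this]
    exact I.smul_of_tower_mem n (h g)

theorem mem_of_mapDomain_eq_zero {I : Ideal (MonoidAlgebra ℤ G)} (f : G → H) (s : H → G)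
    (h : ∀ g, of ℤ G g - of ℤ G (s (f g)) ∈ I) {r : MonoidAlgebra ℤ G}
    (hr : mapDomain f r = 0) : r ∈ I := by
  simpa [hr] using sub_mapDomain_mem f s h r

/-- The augmentation of a group ring. -/
noncomputable def aug (R G : Type*) [CommRing R] [Group G] : MonoidAlgebra R G →ₐ[R] R :=
  MonoidAlgebra.lift R R G 1

@[simp] theorem aug_single {R : Type*} [CommRing R] (g : G) (r : R) :
    aug R G (single g r) = r := by
  simp [aug]

end MonoidAlgebra

/-! ### Annihilators in the group ring and the Koszul complex of the plane. -/

namespace HeisenbergQuotient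

open MonoidAlgebra

variable {k : ℕ}

/-- The integral group ring of the central quotient of the Heisenberg group. -/
abbrev GroupRing (k : ℕ) : Type := MonoidAlgebra ℤ (HeisenbergQuotient k)

/-- The generator `x` as an element of the group ring. -/
noncomputable def X : GroupRing k := of ℤ _ x

/-- The generator `y` as an element of the group ring. -/
noncomputable def Y : GroupRing k := of ℤ _ y

/-- The generator `z` as an element of the group ring. -/
noncomputable def Z : GroupRing k := of ℤ _ z

/-- The norm element `1 + z + ⋯ + z ^ (k - 1)` of the group ring. -/
noncomputable def N : GroupRing k := ∑ i ∈ Finset.range k, Z ^ i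

theorem X_mul_Y : (X * Y : GroupRing k) = Z * Y * X := by
  simp only [X, Y, Z, ← map_mul, x_mul_y, mul_assoc]

theorem commute_Z (r : GroupRing k) : Commute Z r :=
  of_commute (fun g => (Subgroup.mem_center_iff.1 z_mem_center g).symm) r

theorem commute_N (r : GroupRing k) : Commute N r :=
  Commute.sum_left _ _ _ fun i _ => (commute_Z r).pow_left i

theorem commute_Z_sub_one (r : GroupRing k) : Commute (Z - 1) r :=
  (commute_Z r).sub_left (Commute.one_left r)

/-- The fundamental formula of Fox calculus for `[x,y] = z`: the derivatives of the commutator are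
`1 - xyx⁻¹ = 1 - zy` and `x - [x,y] = x - z`. -/
theorem fox_identity : (1 - Z * Y) * (X - 1) + (X - Z) * (Y - 1) = (Z - 1 : GroupRing k) := by
  have h : (1 - Z * Y) * (X - 1) + (X - Z) * (Y - 1) =
      (Z - 1 : GroupRing k) + (X * Y - Z * Y * X) := by noncomm_ring
  rw [h, X_mul_Y, sub_self, add_zero]

theorem N_mul_Z_sub_one : N * (Z - 1 : GroupRing k) = 0 := by
  rw [N, geom_sum_mul, Z, ← map_pow, z_pow, map_one, sub_self]

theorem Z_sub_one_mul_N : (Z - 1 : GroupRing k) * N = 0 := by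
  rw [← (commute_N _).eq, N_mul_Z_sub_one]

/-- The ring homomorphism to the group ring of the free abelian group of rank two. -/
noncomputable def toPlaneRing : GroupRing k →+* MonoidAlgebra ℤ Plane :=
  mapDomainRingHom ℤ toPlane

theorem toPlaneRing_Z : toPlaneRing (Z : GroupRing k) = 1 := by
  simp [toPlaneRing, Z, one_def]

theorem of_sub_of_mem_span_Z (g : HeisenbergQuotient k) :
    of ℤ _ g - of ℤ _ (ofPlane (toPlane g)) ∈ Ideal.span {(Z - 1 : GroupRing k)} := by
  obtain ⟨m, hm⟩ := exists_eq_ofPlane_mul_zpow g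
  have hz : z ∈ subgroupOfIdeal (Ideal.span {(Z - 1 : GroupRing k)}) :=
    Ideal.subset_span rfl
  have hm' : of ℤ _ (z ^ m) - 1 ∈ Ideal.span {(Z - 1 : GroupRing k)} := Subgroup.zpow_mem _ hz m
  have := Ideal.mul_mem_left _ (of ℤ _ (ofPlane (toPlane g))) hm'
  rwa [mul_sub, ← map_mul, ← hm, mul_one] at this

theorem toPlaneRing_eq_zero_iff {r : GroupRing k} :
    toPlaneRing r = 0 ↔ ∃ a, r = a * (Z - 1) := by
  constructor
  · intro h
    obtain ⟨a, ha⟩ := Ideal.mem_span_singleton'.1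
      (mem_of_mapDomain_eq_zero toPlane ofPlane of_sub_of_mem_span_Z h)
    exact ⟨a, ha.symm⟩
  · rintro ⟨a, rfl⟩
    simp [toPlaneRing_Z]

theorem mul_N_eq (r : GroupRing k) : r * N = mapDomain ofPlane (toPlaneRing r) * N := by
  have h : r - mapDomain ofPlane (toPlaneRing r) ∈ Ideal.span {(Z - 1 : GroupRing k)} :=
    sub_mapDomain_mem toPlane ofPlane of_sub_of_mem_span_Z r
  obtain ⟨a, ha⟩ := Ideal.mem_span_singleton'.1 h
  rw [← sub_eq_zero, ← sub_mul, ← ha, mul_assoc, Z_sub_one_mul_N, mul_zero]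

/-- Multiplication by `N` spreads each coefficient over a coset of the centre. As `1, z, …, z ^ (k -
1)` are distinct, only the term `i = 0` meets the section. With `mul_N_eq`, this lets the image of
`r` in the plane ring be read off from `r * N`. -/
theorem coeff_mapDomain_mul_N (hk : 1 ≤ k) (u : MonoidAlgebra ℤ Plane) (q : Plane) :
    (mapDomain ofPlane u * N : GroupRing k).coeff (ofPlane q) = u.coeff q := by
  classical
  induction u using induction_linear with
  | zero => simp
  | add a b ha hb => simp [mapDomain_add, add_mul, ha, hb]
  | single p n =>
    have hterm (i : ℕ) (hi : i ∈ Finset.range k) :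
        (single (ofPlane p * z ^ i : HeisenbergQuotient k) n).coeff (ofPlane q) =
          if i = 0 then (single p n).coeff q else 0 := by
      rw [coeff_single, coeff_single, Finsupp.single_apply, Finsupp.single_apply]
      by_cases hi0 : i = 0
      · simp [hi0, ofPlane_injective.eq_iff]
      · rw [if_neg, if_neg hi0]
        intro h
        have hpq : p = q := by simpa using congrArg toPlane h
        rw [hpq, mul_eq_left] at h
        have := Nat.le_of_dvd (Nat.pos_of_ne_zero hi0) (dvd_of_z_pow_eq_one h)
        rw [Finset.mem_range] at hi
        omega
    have hsum : (mapDomain ofPlane (single p n) * N : GroupRing k) =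
        ∑ i ∈ Finset.range k, single (ofPlane p * z ^ i) n := by
      simp [N, Z, Finset.mul_sum, single_pow, single_mul_single]
    rw [hsum, coeff_sum, Finsupp.finsetSum_apply, Finset.sum_congr rfl hterm]
    simp [show 0 < k from hk]

theorem exists_of_mul_N_eq_zero (hk : 1 ≤ k) {r : GroupRing k} (h : r * N = 0) :
    ∃ a, r = a * (Z - 1) := by
  refine toPlaneRing_eq_zero_iff.1 ?_
  ext q
  rw [← coeff_mapDomain_mul_N hk, ← mul_N_eq, h]
  simp

theorem exists_of_mul_Z_sub_one_eq_zero (hk : 1 ≤ k) {r : GroupRing k} (h : r * (Z - 1) = 0) :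
    ∃ a, r = a * N := by
  -- An element fixed by `z` is multiplied by `k` under the norm; the factor `k` is cancelled at the
  -- end because coefficients lie in `ℤ`.
  have hrN : r * N = k • r := by
    have hZ : r * Z = r := by rwa [mul_sub, mul_one, sub_eq_zero] at h
    have hZi (i : ℕ) : r * Z ^ i = r := by
      induction i with
      | zero => simp
      | succ i ih => rw [pow_succ', ← mul_assoc, hZ, ih]
    simp [N, Finset.mul_sum, hZi]
  let u : MonoidAlgebra ℤ Plane := comapDomain ofPlane ofPlane_injective r
  have hu : toPlaneRing r = k • u := by
    ext q
    rw [← coeff_mapDomain_mul_N hk, ← mul_N_eq, hrN]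
    simp [u, -nsmul_eq_mul]
  refine ⟨mapDomain ofPlane u, ?_⟩
  have hmap : (mapDomain ofPlane (k • u) : GroupRing k) = k • mapDomain ofPlane u :=
    map_nsmul (⟨⟨mapDomain ofPlane, mapDomain_zero _⟩, mapDomain_add _⟩ :
      MonoidAlgebra ℤ Plane →+ GroupRing k) k u
  have hkr : k • r = k • (mapDomain ofPlane u * N : GroupRing k) := by
    rw [← hrN, mul_N_eq, hu, hmap, smul_mul_assoc]
  ext g
  have := congrArg (fun s : GroupRing k => s.coeff g) hkr
  simpa [-nsmul_eq_mul, show k ≠ 0 by omega] using this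

/-- The augmentation of the group ring. -/
noncomputable abbrev augmentation : GroupRing k →ₐ[ℤ] ℤ := aug ℤ (HeisenbergQuotient k)

@[simp] theorem augmentation_X : augmentation (X : GroupRing k) = 1 := aug_single _ _

@[simp] theorem augmentation_Y : augmentation (Y : GroupRing k) = 1 := aug_single _ _

@[simp] theorem augmentation_Z : augmentation (Z : GroupRing k) = 1 := aug_single _ _

@[simp] theorem augmentation_N : augmentation (N : GroupRing k) = k := by simp [N]

/-- The elements congruent to 1 modulo a left ideal form a subgroup. Once it contains the generators
it is everything, so the ideal contains the augmentation ideal. -/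
theorem exists_of_augmentation_eq_zero {r : GroupRing k} (h : augmentation r = 0) :
    ∃ e a b, r = e * (Z - 1) + a * (X - 1) + b * (Y - 1) := by
  let I : Ideal (GroupRing k) := Ideal.span {Z - 1, X - 1, Y - 1}
  have hI : subgroupOfIdeal I = ⊤ :=
    eq_top_of_mem (Ideal.subset_span (by simp [X])) (Ideal.subset_span (by simp [Y]))
      (Ideal.subset_span (by simp [Z]))
  have hmem (g : HeisenbergQuotient k) : of ℤ _ g - 1 ∈ I := by
    have : g ∈ subgroupOfIdeal I := hI ▸ Subgroup.mem_top g
    exact this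
  have key (r : GroupRing k) : r - augmentation r • 1 ∈ I := by
    induction r using induction_linear with
    | zero => simp
    | add a b ha hb =>
      rw [map_add, add_smul, add_sub_add_comm]
      exact I.add_mem ha hb
    | single g n =>
      have : single g n - augmentation (single g n) • (1 : GroupRing k) =
          n • (of ℤ _ g - 1) := by
        rw [aug_single, smul_sub, of_apply, smul_single]
        simp
      rw [this]
      exact I.smul_of_tower_mem n (hmem g)
  have hr : r ∈ I := by simpa [h] using key r
  obtain ⟨e, s, hs, rfl⟩ := Ideal.mem_span_insert.1 hr
  obtain ⟨a, t, ht, rfl⟩ := Ideal.mem_span_insert.1 hs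
  obtain ⟨b, rfl⟩ := Ideal.mem_span_singleton'.1 ht
  exact ⟨e, a, b, by rw [add_assoc]⟩

theorem toPlaneRing_surjective :
    Function.Surjective (toPlaneRing : GroupRing k → MonoidAlgebra ℤ Plane) := by
  intro u
  induction u using induction_linear with
  | zero => exact ⟨0, map_zero _⟩
  | add a b ha hb =>
    obtain ⟨r, rfl⟩ := ha
    obtain ⟨s, rfl⟩ := hb
    exact ⟨r + s, map_add _ _ _⟩
  | single q n => exact ⟨single (ofPlane q) n, by simp [toPlaneRing]⟩

theorem toPlaneRing_Y_sub_one_ne_zero : toPlaneRing (Y - 1 : GroupRing k) ≠ 0 := by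
  rw [map_sub, map_one, sub_ne_zero]
  simp [toPlaneRing, Y, one_def, single_left_inj]

/-- Regularity of the sequence `y - 1`, `x - 1`: setting `y = 1` leaves a domain in which `x - 1` is
nonzero, so `a` is a multiple of `y - 1`, and cancelling `y - 1` then determines `b`. -/
theorem exists_koszul {a b : MonoidAlgebra ℤ Plane}
    (h : a * toPlaneRing (X - 1 : GroupRing k) + b * toPlaneRing (Y - 1 : GroupRing k) = 0) :
    ∃ c, a = c * toPlaneRing (1 - Y : GroupRing k) ∧
      b = c * toPlaneRing (X - 1 : GroupRing k) := by
  have hneg : toPlaneRing (1 - Y : GroupRing k) = -toPlaneRing (Y - 1 : GroupRing k) := by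
    rw [← map_neg, neg_sub]
  let p : MonoidAlgebra ℤ Plane →+* MonoidAlgebra ℤ (Multiplicative ℤ) :=
    mapDomainRingHom ℤ (MonoidHom.fst _ _)
  let I : Ideal (MonoidAlgebra ℤ Plane) := Ideal.span {toPlaneRing (Y - 1 : GroupRing k)}
  have hpa : p a = 0 := by
    have := congrArg p h
    have hY : p (toPlaneRing (Y - 1 : GroupRing k)) = 0 := by
      rw [map_sub, map_one, map_sub, map_one]
      simp [p, toPlaneRing, Y, one_def]
    have hX : p (toPlaneRing (X - 1 : GroupRing k)) ≠ 0 := by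
      rw [map_sub, map_one, map_sub, map_one, sub_ne_zero]
      simp [p, toPlaneRing, X, one_def, single_left_inj]
    rw [map_add, map_mul, map_mul, hY, mul_zero, add_zero, map_zero, mul_eq_zero] at this
    exact this.resolve_right hX
  have haI : a ∈ I := by
    refine mem_of_mapDomain_eq_zero Prod.fst (fun i => (i, 1)) (fun q => ?_) hpa
    have hy : ((1, Multiplicative.ofAdd 1) : Plane) ∈ subgroupOfIdeal I := by
      have : of ℤ Plane (1, Multiplicative.ofAdd 1) - 1 = toPlaneRing (Y - 1 : GroupRing k) := by
        have hY : toPlaneRing (Y : GroupRing k) = of ℤ Plane (toPlane (y : HeisenbergQuotient k)) :=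
          mapDomain_single
        rw [map_sub, map_one toPlaneRing, hY, toPlane_y]
      exact Ideal.subset_span this
    have hq : of ℤ Plane (1, q.2) - 1 ∈ I := by
      have := Subgroup.zpow_mem _ hy (Multiplicative.toAdd q.2)
      have h2 : ((1, Multiplicative.ofAdd 1) : Plane) ^ Multiplicative.toAdd q.2 = (1, q.2) := by
        ext <;> simp [← ofAdd_zsmul]
      rw [h2] at this
      exact this
    have := I.mul_mem_left (of ℤ Plane (q.1, 1)) hq
    rw [mul_sub, ← map_mul, mul_one] at this
    simpa using this
  obtain ⟨c, rfl⟩ := Ideal.mem_span_singleton'.1 haI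
  refine ⟨-c, by rw [hneg]; ring, ?_⟩
  have h2 : (c * toPlaneRing (X - 1 : GroupRing k) + b) * toPlaneRing (Y - 1 : GroupRing k) = 0 := by
    linear_combination h
  have := (mul_eq_zero.1 h2).resolve_right toPlaneRing_Y_sub_one_ne_zero
  linear_combination this

/-- Injectivity at the left end of the Koszul complex. It replaces vertical exactness in vertical
degree 0, where there is no differential out of the column. -/
theorem exists_of_mul_one_sub_Z_mul_Y_eq {b c : GroupRing k} (h : c * (1 - Z * Y) = b * (Z - 1)) :
    ∃ a, c = a * (Z - 1) := by
  refine toPlaneRing_eq_zero_iff.1 ?_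
  have h2 : toPlaneRing c * toPlaneRing (Y - 1 : GroupRing k) = 0 := by
    have := congrArg toPlaneRing h
    simp only [map_mul, map_sub, map_one, toPlaneRing_Z] at this ⊢
    linear_combination -this
  exact (mul_eq_zero.1 h2).resolve_right toPlaneRing_Y_sub_one_ne_zero

theorem exists_of_degree_one_cycle (hk : 1 ≤ k) {e a b : GroupRing k}
    (h : e * (Z - 1) + a * (X - 1) + b * (Y - 1) = 0) :
    ∃ e' a' b' c : GroupRing k, e = e' * N + a' * (X - 1) + b' * (Y - 1) - c ∧
      a = c * (1 - Z * Y) - a' * (Z - 1) ∧ b = c * (X - Z) - b' * (Z - 1) := by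
  have h2 : toPlaneRing a * toPlaneRing (X - 1 : GroupRing k) +
      toPlaneRing b * toPlaneRing (Y - 1 : GroupRing k) = 0 := by
    have := congrArg toPlaneRing h
    simp only [map_mul, map_add, map_sub, map_one, map_zero, toPlaneRing_Z] at this ⊢
    linear_combination this
  obtain ⟨u, hua, hub⟩ := exists_koszul h2
  obtain ⟨c, rfl⟩ := toPlaneRing_surjective (k := k) u
  -- The lifted Koszul chain agrees with the cycle modulo `z - 1`; the discrepancies are the
  -- vertical terms `a'` and `b'`.
  obtain ⟨a', ha'⟩ : ∃ a', c * (1 - Z * Y) - a = a' * (Z - 1) := by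
    refine toPlaneRing_eq_zero_iff.1 ?_
    simp only [map_mul, map_sub, map_one, toPlaneRing_Z, hua]
    ring
  obtain ⟨b', hb'⟩ : ∃ b', c * (X - Z) - b = b' * (Z - 1) := by
    refine toPlaneRing_eq_zero_iff.1 ?_
    simp only [map_mul, map_sub, map_one, toPlaneRing_Z, hub]
    ring
  obtain rfl : a = c * (1 - Z * Y) - a' * (Z - 1) := by rw [← ha']; abel
  obtain rfl : b = c * (X - Z) - b' * (Z - 1) := by rw [← hb']; abel
  obtain ⟨e', he'⟩ : ∃ e', e + c - a' * (X - 1) - b' * (Y - 1) = e' * N := by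
    refine exists_of_mul_Z_sub_one_eq_zero hk ?_
    rw [← h]
    calc (e + c - a' * (X - 1) - b' * (Y - 1)) * (Z - 1)
        = e * (Z - 1) + c * (Z - 1) - a' * ((X - 1) * (Z - 1)) - b' * ((Y - 1) * (Z - 1)) := by
          noncomm_ring
      _ = e * (Z - 1) + c * ((1 - Z * Y) * (X - 1) + (X - Z) * (Y - 1)) -
          a' * ((Z - 1) * (X - 1)) - b' * ((Z - 1) * (Y - 1)) := by
          rw [← (commute_Z_sub_one (X - 1)).eq, ← (commute_Z_sub_one (Y - 1)).eq, fox_identity]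
      _ = _ := by noncomm_ring
  exact ⟨e', a', b', c, by rw [← he']; abel, rfl, rfl⟩

end HeisenbergQuotient

/-! ### Matrices over the group ring as maps of free representations. -/

section FreeMap

open CategoryTheory MonoidAlgebra

variable {R G : Type} [CommRing R] [Group G] {α β γ : Type}

theorem Representation.free_apply_eq_smul (g : G) (v : α →₀ MonoidAlgebra R G) :
    Representation.free R G α g v = of R G g • v := by
  induction v using Finsupp.induction_linear with
  | zero => simp
  | add a b ha hb => rw [map_add, ha, hb, smul_add]
  | single i r =>
    rw [Representation.free, Representation.finsupp_single, Finsupp.smul_single]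
    congr 1
    induction r using MonoidAlgebra.induction_linear with
    | zero => simp
    | add a b ha hb => rw [map_add, ha, hb, smul_add]
    | single h n => simp

variable [Fintype α] [Fintype β] [Fintype γ]

/-- The morphism of free representations given by a matrix over the group ring. -/
noncomputable def Rep.freeMap (D : Matrix α β (MonoidAlgebra R G)) :
    Rep.free R G α ⟶ Rep.free R G β :=
  Rep.ofHom ⟨(Finsupp.linearCombination (MonoidAlgebra R G) fun i =>
      Finsupp.equivFunOnFinite.symm fun j => D i j).restrictScalars R, fun g => by
    refine LinearMap.ext fun v => ?_
    simp only [LinearMap.comp_apply, LinearMap.restrictScalars_apply,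
      Representation.free_apply_eq_smul, map_smul]⟩

theorem Rep.freeMap_apply (D : Matrix α β (MonoidAlgebra R G)) (v : α →₀ MonoidAlgebra R G) :
    (Rep.freeMap D).hom v = Finsupp.equivFunOnFinite.symm (Matrix.vecMul v D) := by
  change Finsupp.linearCombination (MonoidAlgebra R G) _ v = _
  refine Finsupp.ext fun j => ?_
  rw [Finsupp.linearCombination_apply, Finsupp.sum_fintype, Finsupp.finsetSum_apply]
  · rfl
  · exact fun i => zero_smul _ _

theorem Rep.freeMap_comp_freeMap (D : Matrix α β (MonoidAlgebra R G))
    (D' : Matrix β γ (MonoidAlgebra R G)) (h : ∀ v, Matrix.vecMul (Matrix.vecMul v D) D' = 0) :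
    Rep.freeMap D ≫ Rep.freeMap D' = 0 := by
  refine Rep.free_ext _ _ _ _ _ fun i => ?_
  rw [Rep.hom_comp, Representation.IntertwiningMap.comp_apply, Rep.freeMap_apply,
    Rep.freeMap_apply]
  exact (congrArg Finsupp.equivFunOnFinite.symm (h _)).trans (Finsupp.ext fun _ => rfl)

end FreeMap

/-! ### The perturbed double complex: square zero and exactness. -/

namespace HeisenbergQuotient

open CategoryTheory MonoidAlgebra

variable {k : ℕ}

/-- The vertical coefficients of the resolution: alternately `z - 1` and the norm element. -/
noncomputable def verticalCoeff (q : ℕ) : GroupRing k := if Even q then N else Z - 1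

/-- The coefficients of the second-order perturbation in the resolution. -/
noncomputable def perturbationCoeff (q : ℕ) : GroupRing k := if Even q then -1 else 0

theorem verticalCoeff_one : (verticalCoeff 1 : GroupRing k) = Z - 1 := by simp [verticalCoeff]

theorem verticalCoeff_two : (verticalCoeff 2 : GroupRing k) = N := by simp [verticalCoeff]

theorem verticalCoeff_mul (q : ℕ) :
    verticalCoeff (q + 1) * (verticalCoeff q : GroupRing k) = 0 := by
  by_cases hq : Even q <;> simp [verticalCoeff, hq, Nat.even_add_one, N_mul_Z_sub_one,
    Z_sub_one_mul_N]

theorem commute_verticalCoeff (q : ℕ) (r : GroupRing k) : Commute (verticalCoeff q) r := by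
  unfold verticalCoeff
  split_ifs
  exacts [commute_N r, commute_Z_sub_one r]

theorem exists_of_mul_verticalCoeff_eq_zero (hk : 1 ≤ k) (q : ℕ) {r : GroupRing k}
    (h : r * verticalCoeff q = 0) : ∃ s, r = s * verticalCoeff (q + 1) := by
  by_cases hq : Even q
  · simp only [verticalCoeff, hq, if_true, Nat.even_add_one, not_true, if_false] at h ⊢
    exact exists_of_mul_N_eq_zero hk h
  · simp only [verticalCoeff, hq, if_true, Nat.even_add_one, not_false_iff, if_false] at h ⊢
    exact exists_of_mul_Z_sub_one_eq_zero hk h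

theorem perturbation_identity (q : ℕ) : (Z - 1 : GroupRing k) +
    (verticalCoeff (q + 1) * perturbationCoeff q +
      perturbationCoeff (q + 1) * verticalCoeff (q + 2)) = 0 := by
  by_cases hq : Even q <;> simp [verticalCoeff, perturbationCoeff, hq, Nat.even_add_one]

/-- The rank of the resolution in degree `n`. -/
abbrev rank : ℕ → ℕ
  | 0 => 1
  | 1 => 3
  | _ + 2 => 4

/-- The differential of the resolution, as a matrix over the group ring. In degree `n` the basis
elements `0`, `1`, `2`, `3` have horizontal degrees `0`, `1`, `1`, `2`. -/
noncomputable def boundary : (n : ℕ) → Matrix (Fin (rank (n + 1))) (Fin (rank n)) (GroupRing k)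
  | 0 => !![Z - 1; X - 1; Y - 1]
  | 1 => !![N, 0, 0; X - 1, -(Z - 1), 0; Y - 1, 0, -(Z - 1); -1, 1 - Z * Y, X - Z]
  | n + 2 => !![verticalCoeff (n + 3), 0, 0, 0;
      X - 1, -verticalCoeff (n + 2), 0, 0;
      Y - 1, 0, -verticalCoeff (n + 2), 0;
      perturbationCoeff (n + 1), 1 - Z * Y, X - Z, verticalCoeff (n + 1)]

theorem vecMul_boundary_zero (v : Fin 3 → GroupRing k) :
    Matrix.vecMul (n := Fin 1) v (boundary 0) =
      ![v 0 * (Z - 1) + v 1 * (X - 1) + v 2 * (Y - 1)] := by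
  change Matrix.vecMul v !![Z - 1; X - 1; Y - 1] = _
  funext j
  fin_cases j
  simp [Matrix.vecMul, dotProduct, Fin.sum_univ_succ, add_assoc]

theorem vecMul_boundary_one (v : Fin 4 → GroupRing k) :
    Matrix.vecMul (n := Fin 3) v (boundary 1) =
      ![v 0 * N + v 1 * (X - 1) + v 2 * (Y - 1) - v 3,
        v 3 * (1 - Z * Y) - v 1 * (Z - 1), v 3 * (X - Z) - v 2 * (Z - 1)] := by
  change Matrix.vecMul v
    !![N, 0, 0; X - 1, -(Z - 1), 0; Y - 1, 0, -(Z - 1); -1, 1 - Z * Y, X - Z] = _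
  funext j
  fin_cases j <;> simp only [Matrix.vecMul, dotProduct, Fin.sum_univ_four] <;> simp <;> noncomm_ring

theorem vecMul_boundary_add_two (n : ℕ) (v : Fin 4 → GroupRing k) :
    Matrix.vecMul (n := Fin 4) v (boundary (n + 2)) =
      ![v 0 * verticalCoeff (n + 3) + v 1 * (X - 1) + v 2 * (Y - 1) +
          v 3 * perturbationCoeff (n + 1),
        v 3 * (1 - Z * Y) - v 1 * verticalCoeff (n + 2),
        v 3 * (X - Z) - v 2 * verticalCoeff (n + 2), v 3 * verticalCoeff (n + 1)] := by
  change Matrix.vecMul v !![verticalCoeff (n + 3), 0, 0, 0;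
      X - 1, -verticalCoeff (n + 2), 0, 0;
      Y - 1, 0, -verticalCoeff (n + 2), 0;
      perturbationCoeff (n + 1), 1 - Z * Y, X - Z, verticalCoeff (n + 1)] = _
  funext j
  fin_cases j <;> simp only [Matrix.vecMul, dotProduct, Fin.sum_univ_four] <;> simp <;> noncomm_ring

/-- The vertical coefficients are central, so mixed squares cancel by sign, and consecutive ones
multiply to 0. The entry from horizontal degree 2 to 0 vanishes by `perturbation_identity`. -/
theorem vecMul_vecMul_boundary (n : ℕ) (v : Fin (rank (n + 2)) → GroupRing k) :
    Matrix.vecMul (Matrix.vecMul v (boundary (n + 1))) (boundary n) = 0 := by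
  have hcomm (r : GroupRing k) (q : ℕ) : r * verticalCoeff q - verticalCoeff q * r = 0 :=
    sub_eq_zero.2 (commute_verticalCoeff q r).eq.symm
  have hfox (q : ℕ) : perturbationCoeff (q + 1) * verticalCoeff (q + 2) +
      ((1 - Z * Y) * (X - 1) + (X - Z) * (Y - 1)) +
      verticalCoeff (q + 1) * perturbationCoeff q = (0 : GroupRing k) := by
    rw [fox_identity, ← perturbation_identity q]
    abel
  match n, v with
  | 0, v =>
    rw [vecMul_boundary_one, vecMul_boundary_zero]
    funext j
    fin_cases j
    change (v 0 * N + v 1 * (X - 1) + v 2 * (Y - 1) - v 3) * (Z - 1) +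
      (v 3 * (1 - Z * Y) - v 1 * (Z - 1)) * (X - 1) +
      (v 3 * (X - Z) - v 2 * (Z - 1)) * (Y - 1) = 0
    rw [← verticalCoeff_one]
    calc _ = v 0 * (N * verticalCoeff 1) +
          v 1 * ((X - 1) * verticalCoeff 1 - verticalCoeff 1 * (X - 1)) +
          v 2 * ((Y - 1) * verticalCoeff 1 - verticalCoeff 1 * (Y - 1)) +
          v 3 * ((1 - Z * Y) * (X - 1) + (X - Z) * (Y - 1) - verticalCoeff 1) := by noncomm_ring
      _ = 0 := by
        rw [hcomm, hcomm, fox_identity, verticalCoeff_one, N_mul_Z_sub_one]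
        simp
  | 1, v =>
    rw [vecMul_boundary_add_two, vecMul_boundary_one]
    funext j
    fin_cases j
    · change (v 0 * verticalCoeff 3 + v 1 * (X - 1) + v 2 * (Y - 1) +
          v 3 * perturbationCoeff 1) * N +
        (v 3 * (1 - Z * Y) - v 1 * verticalCoeff 2) * (X - 1) +
        (v 3 * (X - Z) - v 2 * verticalCoeff 2) * (Y - 1) - v 3 * verticalCoeff 1 = 0
      rw [← verticalCoeff_two]
      calc _ = v 0 * (verticalCoeff 3 * verticalCoeff 2) +
          v 1 * ((X - 1) * verticalCoeff 2 - verticalCoeff 2 * (X - 1)) +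
          v 2 * ((Y - 1) * verticalCoeff 2 - verticalCoeff 2 * (Y - 1)) +
          v 3 * (perturbationCoeff 1 * verticalCoeff 2 +
            ((1 - Z * Y) * (X - 1) + (X - Z) * (Y - 1)) + verticalCoeff 1 * -1) := by noncomm_ring
        _ = 0 := by
          have := hfox 0
          rw [show perturbationCoeff 0 = (-1 : GroupRing k) by simp [perturbationCoeff]] at this
          rw [hcomm, hcomm, this, verticalCoeff_mul]
          simp
    · change v 3 * verticalCoeff 1 * (1 - Z * Y) -
        (v 3 * (1 - Z * Y) - v 1 * verticalCoeff 2) * (Z - 1) = 0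
      rw [← verticalCoeff_one]
      calc _ = v 1 * (verticalCoeff 2 * verticalCoeff 1) -
          v 3 * ((1 - Z * Y) * verticalCoeff 1 - verticalCoeff 1 * (1 - Z * Y)) := by noncomm_ring
        _ = 0 := by
          rw [hcomm, verticalCoeff_mul]
          simp
    · change v 3 * verticalCoeff 1 * (X - Z) -
        (v 3 * (X - Z) - v 2 * verticalCoeff 2) * (Z - 1) = 0
      rw [← verticalCoeff_one]
      calc _ = v 2 * (verticalCoeff 2 * verticalCoeff 1) -
          v 3 * ((X - Z) * verticalCoeff 1 - verticalCoeff 1 * (X - Z)) := by noncomm_ring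
        _ = 0 := by
          rw [hcomm, verticalCoeff_mul]
          simp
  | n + 2, v =>
    rw [vecMul_boundary_add_two (n + 1), vecMul_boundary_add_two n]
    funext j
    fin_cases j
    · change (v 0 * verticalCoeff (n + 4) + v 1 * (X - 1) + v 2 * (Y - 1) +
          v 3 * perturbationCoeff (n + 2)) * verticalCoeff (n + 3) +
        (v 3 * (1 - Z * Y) - v 1 * verticalCoeff (n + 3)) * (X - 1) +
        (v 3 * (X - Z) - v 2 * verticalCoeff (n + 3)) * (Y - 1) +
        v 3 * verticalCoeff (n + 2) * perturbationCoeff (n + 1) = 0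
      calc _ = v 0 * (verticalCoeff (n + 4) * verticalCoeff (n + 3)) +
          v 1 * ((X - 1) * verticalCoeff (n + 3) - verticalCoeff (n + 3) * (X - 1)) +
          v 2 * ((Y - 1) * verticalCoeff (n + 3) - verticalCoeff (n + 3) * (Y - 1)) +
          v 3 * (perturbationCoeff (n + 2) * verticalCoeff (n + 3) +
            ((1 - Z * Y) * (X - 1) + (X - Z) * (Y - 1)) +
            verticalCoeff (n + 2) * perturbationCoeff (n + 1)) := by noncomm_ring
        _ = 0 := by
          rw [hcomm, hcomm, hfox (n + 1), verticalCoeff_mul (n + 3)]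
          simp
    · change v 3 * verticalCoeff (n + 2) * (1 - Z * Y) -
        (v 3 * (1 - Z * Y) - v 1 * verticalCoeff (n + 3)) * verticalCoeff (n + 2) = 0
      calc _ = v 1 * (verticalCoeff (n + 3) * verticalCoeff (n + 2)) -
          v 3 * ((1 - Z * Y) * verticalCoeff (n + 2) - verticalCoeff (n + 2) * (1 - Z * Y)) := by
            noncomm_ring
        _ = 0 := by
          rw [hcomm, verticalCoeff_mul (n + 2)]
          simp
    · change v 3 * verticalCoeff (n + 2) * (X - Z) -
        (v 3 * (X - Z) - v 2 * verticalCoeff (n + 3)) * verticalCoeff (n + 2) = 0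
      calc _ = v 2 * (verticalCoeff (n + 3) * verticalCoeff (n + 2)) -
          v 3 * ((X - Z) * verticalCoeff (n + 2) - verticalCoeff (n + 2) * (X - Z)) := by
            noncomm_ring
        _ = 0 := by
          rw [hcomm, verticalCoeff_mul (n + 2)]
          simp
    · change v 3 * verticalCoeff (n + 2) * verticalCoeff (n + 1) = 0
      rw [mul_assoc, verticalCoeff_mul (n + 1), mul_zero]

/-- The staircase: given a lift `c` of the component of horizontal degree 2, correct by its boundary
and lift through the exact columns of horizontal degree 1, then 0. -/
theorem exists_of_cycle_lift (hk : 1 ≤ k) (q : ℕ) {e a b c : GroupRing k}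
    (ha : c * verticalCoeff (q + 1) * (1 - Z * Y) - a * verticalCoeff (q + 1) = 0)
    (hb : c * verticalCoeff (q + 1) * (X - Z) - b * verticalCoeff (q + 1) = 0)
    (he : e * verticalCoeff (q + 2) + a * (X - 1) + b * (Y - 1) +
      c * verticalCoeff (q + 1) * perturbationCoeff q = 0) :
    ∃ e' a' b' : GroupRing k,
      e = e' * verticalCoeff (q + 3) + a' * (X - 1) + b' * (Y - 1) +
        c * perturbationCoeff (q + 1) ∧
      a = c * (1 - Z * Y) - a' * verticalCoeff (q + 2) ∧
      b = c * (X - Z) - b' * verticalCoeff (q + 2) := by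
  have lift {r s : GroupRing k}
      (h : c * verticalCoeff (q + 1) * r - s * verticalCoeff (q + 1) = 0) :
      ∃ t, s = c * r - t * verticalCoeff (q + 2) := by
    -- Centrality turns the equation into `(c * r - s) * verticalCoeff (q + 1) = 0`, to which column
    -- exactness applies.
    rw [mul_assoc, (commute_verticalCoeff (q + 1) r).eq, ← mul_assoc, ← sub_mul] at h
    obtain ⟨t, ht⟩ := exists_of_mul_verticalCoeff_eq_zero hk _ h
    exact ⟨t, by rw [← ht]; abel⟩
  obtain ⟨a', rfl⟩ := lift ha
  obtain ⟨b', rfl⟩ := lift hb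
  have hX := (commute_verticalCoeff (q + 2) (X - 1 : GroupRing k)).eq
  have hY := (commute_verticalCoeff (q + 2) (Y - 1 : GroupRing k)).eq
  obtain ⟨e', he'⟩ : ∃ e', e - a' * (X - 1) - b' * (Y - 1) - c * perturbationCoeff (q + 1) =
      e' * verticalCoeff (q + 3) := by
    refine exists_of_mul_verticalCoeff_eq_zero hk (q + 2) ?_
    calc _ = (e * verticalCoeff (q + 2) +
            (c * (1 - Z * Y) - a' * verticalCoeff (q + 2)) * (X - 1) +
            (c * (X - Z) - b' * verticalCoeff (q + 2)) * (Y - 1) +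
            c * verticalCoeff (q + 1) * perturbationCoeff q) +
          a' * (verticalCoeff (q + 2) * (X - 1) - (X - 1) * verticalCoeff (q + 2)) +
          b' * (verticalCoeff (q + 2) * (Y - 1) - (Y - 1) * verticalCoeff (q + 2)) -
          c * (((1 - Z * Y) * (X - 1) + (X - Z) * (Y - 1)) +
            (verticalCoeff (q + 1) * perturbationCoeff q +
              perturbationCoeff (q + 1) * verticalCoeff (q + 2))) := by noncomm_ring
      _ = 0 := by
        rw [he, hX, hY, fox_identity, perturbation_identity]
        simp
  exact ⟨e', a', b', by rw [← he']; abel, rfl, rfl⟩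

theorem exists_of_vecMul_boundary_eq_zero (hk : 1 ≤ k) (n : ℕ)
    (v : Fin (rank (n + 1)) → GroupRing k) (hv : Matrix.vecMul v (boundary n) = 0) :
    ∃ u, v = Matrix.vecMul u (boundary (n + 1)) := by
  match n, v with
  | 0, v =>
    rw [vecMul_boundary_zero] at hv
    obtain ⟨e', a', b', c, h0, h1, h2⟩ := exists_of_degree_one_cycle hk (congrFun hv 0)
    refine ⟨![e', a', b', c], ?_⟩
    rw [vecMul_boundary_one]
    funext j
    fin_cases j
    exacts [h0, h1, h2]
  | 1, v =>
    rw [vecMul_boundary_one] at hv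
    have he : v 0 * N + v 1 * (X - 1) + v 2 * (Y - 1) - v 3 = 0 := congrFun hv 0
    have ha : v 3 * (1 - Z * Y) - v 1 * (Z - 1) = 0 := congrFun hv 1
    have hb : v 3 * (X - Z) - v 2 * (Z - 1) = 0 := congrFun hv 2
    obtain ⟨c, hc⟩ := exists_of_mul_one_sub_Z_mul_Y_eq (sub_eq_zero.1 ha)
    rw [hc] at he ha hb
    obtain ⟨e', a', b', h0, h1, h2⟩ := exists_of_cycle_lift hk 0 (e := v 0) (a := v 1) (b := v 2)
      (c := c) (by rwa [verticalCoeff_one]) (by rwa [verticalCoeff_one])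
      (by rw [verticalCoeff_one, verticalCoeff_two, ← he]; simp [perturbationCoeff]; noncomm_ring)
    refine ⟨![e', a', b', c], ?_⟩
    rw [vecMul_boundary_add_two]
    funext j
    fin_cases j
    exacts [h0, h1, h2, hc.trans (by rw [← verticalCoeff_one]; rfl)]
  | n + 2, v =>
    rw [vecMul_boundary_add_two] at hv
    have he : v 0 * verticalCoeff (n + 3) + v 1 * (X - 1) + v 2 * (Y - 1) +
      v 3 * perturbationCoeff (n + 1) = 0 := congrFun hv 0
    have ha : v 3 * (1 - Z * Y) - v 1 * verticalCoeff (n + 2) = 0 := congrFun hv 1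
    have hb : v 3 * (X - Z) - v 2 * verticalCoeff (n + 2) = 0 := congrFun hv 2
    obtain ⟨c, hc⟩ := exists_of_mul_verticalCoeff_eq_zero hk (n + 1) (congrFun hv 3)
    rw [hc] at he ha hb
    obtain ⟨e', a', b', h0, h1, h2⟩ := exists_of_cycle_lift hk (n + 1) ha hb he
    refine ⟨![e', a', b', c], ?_⟩
    rw [vecMul_boundary_add_two (n + 1)]
    funext j
    fin_cases j
    exacts [h0, h1, h2, hc]

end HeisenbergQuotient

/-! ### From elementwise exactness to a quasi-isomorphism. -/

section QuasiIso

open CategoryTheory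

theorem Rep.exact_of_forall {R G : Type} [CommRing R] [Group G] (S : ShortComplex (Rep.{0} R G))
    (h : ∀ v : S.X₂, S.g.hom v = 0 → ∃ u : S.X₁, S.f.hom u = v) : S.Exact := by
  apply (forget₂ (Rep.{0} R G) (ModuleCat.{0} R)).reflects_exact_of_faithful
  rw [ShortComplex.moduleCat_exact_iff]
  intro v hv
  exact h v hv

theorem Rep.quasiIso_toSingle₀Equiv_symm {R G : Type} [CommRing R] [Group G]
    (K : ChainComplex (Rep.{0} R G) ℕ) (A : Rep.{0} R G) (π : K.X 0 ⟶ A) (hπ : K.d 1 0 ≫ π = 0)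
    (hsurj : Function.Surjective π.hom)
    (hzero : ∀ v : K.X 0, π.hom v = 0 → ∃ u : K.X 1, (K.d 1 0).hom u = v)
    (hsucc : ∀ n, ∀ v : K.X (n + 1), (K.d (n + 1) n).hom v = 0 →
      ∃ u : K.X (n + 2), (K.d (n + 2) (n + 1)).hom u = v) :
    QuasiIso ((K.toSingle₀Equiv A).symm ⟨π, hπ⟩) where
  quasiIsoAt m := by
    induction m with
    | zero =>
      rw [ChainComplex.quasiIsoAt₀_iff, ShortComplex.quasiIso_iff_of_zeros' _ (K.shape _ _ (by simp)) rfl rfl]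
      have h0 := ChainComplex.toSingle₀Equiv_symm_apply_f_zero π hπ
      constructor
      · apply Rep.exact_of_forall
        intro v hv
        have hv' : (((K.toSingle₀Equiv A).symm ⟨π, hπ⟩).f 0).hom v = 0 := hv
        rw [h0] at hv'
        exact hzero v hv'
      · change Epi (((K.toSingle₀Equiv A).symm ⟨π, hπ⟩).f 0)
        rw [h0]
        exact (Rep.epi_iff_surjective _).2 hsurj
    | succ m _ =>
      rw [quasiIsoAt_iff_exactAt' (hL := ChainComplex.exactAt_succ_single_obj ..),
          HomologicalComplex.exactAt_iff' _ (m + 2) (m + 1) m (by simp) (by simp)]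
      apply Rep.exact_of_forall
      exact hsucc m

end QuasiIso

/-! ### The projective resolution. -/

namespace HeisenbergQuotient

open CategoryTheory MonoidAlgebra

variable {k : ℕ}

/-- The complex of free representations underlying the resolution. -/
noncomputable def freeComplex (k : ℕ) : ChainComplex (Rep ℤ (HeisenbergQuotient k)) ℕ :=
  ChainComplex.of (fun n => Rep.free ℤ (HeisenbergQuotient k) (Fin (rank n)))
    (fun n => Rep.freeMap (boundary n))
    (fun n => Rep.freeMap_comp_freeMap _ _ fun v => vecMul_vecMul_boundary n v)

theorem freeComplex_d (n : ℕ) : (freeComplex k).d (n + 1) n = Rep.freeMap (boundary n) :=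
  ChainComplex.of_d (fun n => Rep.free ℤ (HeisenbergQuotient k) (Fin (rank n)))
    (fun n => Rep.freeMap (boundary n)) n

/-- The augmentation of the free complex in degree zero. -/
noncomputable def augmentationHom (k : ℕ) :
    Rep.free ℤ (HeisenbergQuotient k) (Fin 1) ⟶ Rep.trivial ℤ (HeisenbergQuotient k) ℤ :=
  Rep.ofHom ⟨augmentation.toLinearMap ∘ₗ Finsupp.lapply 0, fun g => by
    refine LinearMap.ext fun v => ?_
    simp [Representation.free_apply_eq_smul]⟩

theorem augmentationHom_apply (v : Fin 1 →₀ GroupRing k) :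
    (augmentationHom k).hom v = augmentation (v 0) := rfl

theorem freeMap_comp_augmentationHom :
    Rep.freeMap (boundary 0) ≫ augmentationHom k = 0 := by
  refine Rep.free_ext _ _ _ _ _ fun i => ?_
  rw [Rep.hom_comp, Representation.IntertwiningMap.comp_apply, Rep.freeMap_apply]
  refine (augmentationHom_apply _).trans ?_
  rw [vecMul_boundary_zero]
  simp

/-- The augmentation from the free complex to the trivial representation. -/
noncomputable def resolutionπ (k : ℕ) : freeComplex k ⟶
    (ChainComplex.single₀ (Rep ℤ (HeisenbergQuotient k))).obj
      (Rep.trivial ℤ (HeisenbergQuotient k) ℤ) :=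
  ((freeComplex k).toSingle₀Equiv _).symm ⟨augmentationHom k, by
    rw [freeComplex_d]
    exact freeMap_comp_augmentationHom⟩

theorem exists_freeMap_boundary_eq (hk : 1 ≤ k) (n : ℕ) (v : Fin (rank (n + 1)) →₀ GroupRing k)
    (hv : (Rep.freeMap (boundary n)).hom v = 0) :
    ∃ u : Fin (rank (n + 2)) →₀ GroupRing k, (Rep.freeMap (boundary (n + 1))).hom u = v := by
  rw [Rep.freeMap_apply] at hv
  have hv' : Matrix.vecMul v (boundary n) = 0 := funext fun j => DFunLike.congr_fun hv j
  obtain ⟨u, hu⟩ := exists_of_vecMul_boundary_eq_zero hk n v hv'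
  refine ⟨Finsupp.equivFunOnFinite.symm u, ?_⟩
  rw [Rep.freeMap_apply]
  exact Finsupp.ext fun j => (congrFun hu j).symm

theorem resolutionπ_quasiIso (hk : 1 ≤ k) : QuasiIso (resolutionπ k) := by
  refine Rep.quasiIso_toSingle₀Equiv_symm _ _ _ _ ?_ ?_ ?_
  · intro n
    refine ⟨Finsupp.single (0 : Fin 1) (single 1 n), (augmentationHom_apply _).trans ?_⟩
    simp
  · intro v hv
    obtain ⟨e, a, b, h⟩ := exists_of_augmentation_eq_zero ((augmentationHom_apply v).symm.trans hv)
    refine ⟨Finsupp.equivFunOnFinite.symm (![e, a, b] : Fin 3 → GroupRing k), ?_⟩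
    rw [freeComplex_d]
    refine (Rep.freeMap_apply _ _).trans (Finsupp.ext fun j => ?_)
    refine (congrFun (vecMul_boundary_zero _) j).trans ?_
    fin_cases j
    exact h.symm
  · intro n v hv
    rw [freeComplex_d] at hv ⊢
    exact exists_freeMap_boundary_eq hk n v hv

/-- A free resolution of the trivial representation of the central quotient of the Heisenberg
group. -/
noncomputable def resolution (hk : 1 ≤ k) :
    ProjectiveResolution (Rep.trivial ℤ (HeisenbergQuotient k) ℤ) where
  complex := freeComplex k
  projective n := (inferInstance : Projective (Rep.free ℤ (HeisenbergQuotient k) (Fin (rank n))))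
  π := resolutionπ k
  quasiIso := resolutionπ_quasiIso hk

end HeisenbergQuotient

/-! ### Homology and cohomology of free complexes by augmented matrices. -/

section HomologyComputation

open CategoryTheory MonoidAlgebra Representation

/-- The first isomorphism theorem in coordinates: `φ` restricted to cycles is onto `T` with kernel
the boundaries. It reduces each later case to integer linear algebra. -/
theorem CategoryTheory.ShortComplex.nonempty_homology_addEquiv {R : Type} [Ring R]
    (S : ShortComplex (ModuleCat.{0} R)) {M₁ M₂ M₃ T : Type} [AddCommGroup M₂]
    [AddCommGroup T] [Zero M₃] (e₁ : S.X₁ ≃ M₁) (e₂ : S.X₂ ≃+ M₂) (e₃ : S.X₃ ≃ M₃)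
    (h₃ : e₃ 0 = 0) (f : M₁ → M₂) (g : M₂ → M₃) (hf : ∀ x, e₂ (S.f.hom x) = f (e₁ x))
    (hg : ∀ x, e₃ (S.g.hom x) = g (e₂ x)) (φ : M₂ →+ T)
    (surj : ∀ t, ∃ m, g m = 0 ∧ φ m = t) (hker : ∀ m, g m = 0 → (φ m = 0 ↔ ∃ a, f a = m)) :
    Nonempty (S.homology ≃+ T) := by
  have hg0 (x : S.X₂) : S.g.hom x = 0 ↔ g (e₂ x) = 0 := by
    rw [← hg, ← h₃, e₃.apply_eq_iff_eq]
  let K : Submodule R S.X₂ := LinearMap.ker S.g.hom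
  let B : Submodule R K := LinearMap.range S.moduleCatToCycles
  let ψ : K →+ T := (φ.comp e₂.toAddMonoidHom).comp K.subtype.toAddMonoidHom
  have hψ : Function.Surjective ψ := by
    intro t
    obtain ⟨m, hm, rfl⟩ := surj t
    exact ⟨⟨e₂.symm m, (hg0 _).2 (by simpa using hm)⟩, by simp [ψ]⟩
  have hker' : B.toAddSubgroup = ψ.ker := by
    ext ⟨x, hx⟩
    change _ ↔ φ (e₂ x) = 0
    rw [hker _ ((hg0 x).1 hx)]
    constructor
    · rintro ⟨u, hu⟩
      refine ⟨e₁ u, ?_⟩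
      rw [← hf]
      exact congrArg e₂ (congrArg Subtype.val hu)
    · rintro ⟨a, ha⟩
      refine ⟨e₁.symm a, Subtype.ext (e₂.injective ?_)⟩
      rw [← ha]
      exact (hf _).trans (by simp)
  exact ⟨S.moduleCatHomologyIso.toLinearEquiv.toAddEquiv.trans
    ((QuotientAddGroup.quotientAddEquivOfEq hker').trans
      (QuotientAddGroup.quotientKerEquivOfSurjective ψ hψ))⟩

theorem HomologicalComplex.nonempty_homology_addEquiv {R ι : Type} [Ring R] {c : ComplexShape ι}
    (K : HomologicalComplex (ModuleCat.{0} R) c) (i j l : ι) (hi : c.prev j = i)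
    (hl : c.next j = l) {M₁ M₂ M₃ T : Type} [AddCommGroup M₂]
    [AddCommGroup T] [Zero M₃] (e₁ : K.X i ≃ M₁) (e₂ : K.X j ≃+ M₂) (e₃ : K.X l ≃ M₃)
    (h₃ : e₃ 0 = 0) (f : M₁ → M₂) (g : M₂ → M₃) (hf : ∀ x, e₂ ((K.d i j).hom x) = f (e₁ x))
    (hg : ∀ x, e₃ ((K.d j l).hom x) = g (e₂ x)) (φ : M₂ →+ T)
    (surj : ∀ t, ∃ m, g m = 0 ∧ φ m = t) (hker : ∀ m, g m = 0 → (φ m = 0 ↔ ∃ a, f a = m)) :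
    Nonempty (K.homology j ≃+ T) := by
  obtain ⟨e⟩ := (K.sc' i j l).nonempty_homology_addEquiv e₁ e₂ e₃ h₃ f g hf hg φ surj hker
  exact ⟨(ShortComplex.homologyMapIso (K.isoSc' i j l hi hl)).toLinearEquiv.toAddEquiv.trans e⟩

variable {R G : Type} [CommRing R] [Group G] {α β : Type}

theorem Rep.coinvariantsTensorFreeToFinsupp_mk_tmul [DecidableEq α] (a : R) (v : α →₀ MonoidAlgebra R G) (i : α) :
    Rep.coinvariantsTensorFreeToFinsupp (Rep.trivial R G R) α
      (Coinvariants.mk _ (TensorProduct.tmul R a v)) i = a * aug R G (v i) := by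
  induction v using Finsupp.induction_linear with
  | zero => simp
  | add v w hv hw =>
    rw [TensorProduct.tmul_add, map_add, map_add, Finsupp.add_apply, hv, hw, Finsupp.add_apply,
      map_add, mul_add]
  | single j r =>
    induction r using MonoidAlgebra.induction_linear with
    | zero => simp
    | add r s hr hs =>
      rw [Finsupp.single_add, TensorProduct.tmul_add, map_add, map_add, Finsupp.add_apply, hr, hs,
        Finsupp.add_apply, map_add, mul_add]
    | single g s =>
      refine (DFunLike.congr_fun (coinvariantsTensorFreeToFinsupp_mk_tmul_single
        (A := Rep.trivial R G R) a j g s) i).trans ?_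
      rw [Finsupp.single_apply, Finsupp.single_apply]
      split_ifs <;> simp [aug_single, mul_comm]

/-- The morphisms from a free representation of finite rank to the trivial representation. -/
noncomputable def Rep.freeHomEquiv (R G α : Type) [CommRing R] [Group G] :
    (Rep.free R G α ⟶ Rep.trivial R G R) ≃+ (α → R) :=
  (Rep.freeLiftLEquiv R G α (Rep.trivial R G R)).toAddEquiv

theorem Rep.freeHomEquiv_apply (f : Rep.free R G α ⟶ Rep.trivial R G R) (i : α) :
    Rep.freeHomEquiv R G α f i = f.hom (Finsupp.single i (single 1 1)) := rfl

variable [Fintype α] [Fintype β]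

/-- The coinvariants of a free representation of finite rank. -/
noncomputable def Rep.coinvariantsTensorFreeEquiv (R G α : Type) [CommRing R] [Group G]
    [Fintype α] [DecidableEq α] :
    ((Rep.coinvariantsTensor R G).obj (Rep.trivial R G R)).obj (Rep.free R G α) ≃+ (α → R) :=
  (Rep.coinvariantsTensorFreeLEquiv (Rep.trivial R G R) α).toAddEquiv.trans
    (Finsupp.linearEquivFunOnFinite R R α).toAddEquiv

theorem Rep.coinvariantsTensorFreeEquiv_mk_tmul [DecidableEq α] (a : R)
    (v : α →₀ MonoidAlgebra R G) :
    Rep.coinvariantsTensorFreeEquiv R G α (Coinvariants.mk _ (TensorProduct.tmul R a v)) =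
      fun i => a * aug R G (v i) :=
  funext fun i => Rep.coinvariantsTensorFreeToFinsupp_mk_tmul a v i

theorem Rep.coinvariantsTensorFreeEquiv_map [DecidableEq α] [DecidableEq β]
    (D : Matrix α β (MonoidAlgebra R G))
    (x : ((Rep.coinvariantsTensor R G).obj (Rep.trivial R G R)).obj (Rep.free R G α)) :
    Rep.coinvariantsTensorFreeEquiv R G β
        ((((Rep.coinvariantsTensor R G).obj (Rep.trivial R G R)).map (Rep.freeMap D)).hom x) =
      Matrix.vecMul (Rep.coinvariantsTensorFreeEquiv R G α x) (D.map (aug R G)) := by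
  obtain ⟨t, rfl⟩ := Coinvariants.mk_surjective _ x
  induction t using TensorProduct.induction_on with
  | zero => simp
  | add t s ht hs =>
    rw [map_add, map_add, map_add, map_add, ht, hs, Matrix.add_vecMul]
  | tmul a v =>
    rw [Rep.coinvariantsTensorFreeEquiv_mk_tmul]
    refine (Rep.coinvariantsTensorFreeEquiv_mk_tmul a ((Rep.freeMap D).hom v)).trans ?_
    rw [Rep.freeMap_apply]
    funext j
    simp [Matrix.vecMul, dotProduct, Finset.mul_sum, mul_assoc]

theorem Rep.hom_trivial_apply [DecidableEq α] (f : Rep.free R G α ⟶ Rep.trivial R G R)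
    (v : α →₀ MonoidAlgebra R G) :
    f.hom v = ∑ i, aug R G (v i) * Rep.freeHomEquiv R G α f i := by
  obtain ⟨u, rfl⟩ := (Rep.freeHomEquiv R G α).symm.surjective f
  rw [AddEquiv.apply_symm_apply]
  induction v using Finsupp.induction_linear with
  | zero => simp
  | add v w hv hw =>
    rw [map_add, hv, hw, ← Finset.sum_add_distrib]
    exact Finset.sum_congr rfl fun i _ => by rw [Finsupp.add_apply, map_add, add_mul]
  | single j r =>
    induction r using MonoidAlgebra.induction_linear with
    | zero => simp
    | add r s hr hs =>
      rw [Finsupp.single_add, map_add, hr, hs, ← Finset.sum_add_distrib]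
      exact Finset.sum_congr rfl fun i _ => by rw [Finsupp.add_apply, map_add, add_mul]
    | single g s =>
      refine (freeLift_single_single (Rep.trivial R G R).ρ j g s u).trans ?_
      rw [Finset.sum_eq_single j]
      · simp [aug_single]
      · intro i _ hi
        rw [Finsupp.single_eq_of_ne hi, map_zero, zero_mul]
      · simp

/-- A map to the trivial representation sees coefficients only through the augmentation.
Precomposition therefore acts on columns, while coinvariants use the same matrix on rows. -/
theorem Rep.freeHomEquiv_comp [DecidableEq α] [DecidableEq β] (D : Matrix α β (MonoidAlgebra R G))
    (f : Rep.free R G β ⟶ Rep.trivial R G R) :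
    Rep.freeHomEquiv R G α (Rep.freeMap D ≫ f) =
      Matrix.mulVec (D.map (aug R G)) (Rep.freeHomEquiv R G β f) := by
  funext i
  rw [Rep.freeHomEquiv_apply, Rep.hom_comp, Representation.IntertwiningMap.comp_apply,
    Rep.hom_trivial_apply, Rep.freeMap_apply, ← one_def, Finsupp.single_eq_pi_single,
    Matrix.single_one_vecMul]
  simp [Matrix.mulVec, dotProduct]

end HomologyComputation

/-! ### The integral differentials. -/

namespace HeisenbergQuotient

open CategoryTheory MonoidAlgebra

variable {k : ℕ}

/-- The integral matrix of the differential of the resolution on coinvariants. -/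
noncomputable def integralBoundary (k n : ℕ) : Matrix (Fin (rank (n + 1))) (Fin (rank n)) ℤ :=
  (boundary n : Matrix _ _ (GroupRing k)).map augmentation

theorem integralBoundary_zero : integralBoundary k 0 = 0 := by
  change Matrix.map (!![Z - 1; X - 1; Y - 1] : Matrix (Fin 3) (Fin 1) (GroupRing k)) _ = 0
  ext i j
  fin_cases i <;> fin_cases j <;> simp

theorem integralBoundary_one :
    integralBoundary k 1 = !![(k : ℤ), 0, 0; 0, 0, 0; 0, 0, 0; -1, 0, 0] := by
  change Matrix.map !![N, 0, 0; X - 1, -(Z - 1), 0; Y - 1, 0, -(Z - 1); -1, 1 - Z * Y, X - Z] _ = _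
  ext i j
  fin_cases i <;> fin_cases j <;> simp

theorem integralBoundary_add_two_of_even {n : ℕ} (hn : Even n) : integralBoundary k (n + 2) =
    !![0, 0, 0, 0; 0, -(k : ℤ), 0, 0; 0, 0, -(k : ℤ), 0; 0, 0, 0, 0] := by
  change Matrix.map !![verticalCoeff (n + 3), 0, 0, 0;
      X - 1, -verticalCoeff (n + 2), 0, 0;
      Y - 1, 0, -verticalCoeff (n + 2), 0;
      perturbationCoeff (n + 1), 1 - Z * Y, X - Z, verticalCoeff (n + 1)] _ = _
  ext i j
  fin_cases i <;> fin_cases j <;>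
    simp [verticalCoeff, perturbationCoeff, hn, Nat.even_add_one]

theorem integralBoundary_add_two_of_odd {n : ℕ} (hn : Odd n) : integralBoundary k (n + 2) =
    !![(k : ℤ), 0, 0, 0; 0, 0, 0, 0; 0, 0, 0, 0; -1, 0, 0, (k : ℤ)] := by
  have hn' : ¬Even n := Nat.not_even_iff_odd.2 hn
  change Matrix.map !![verticalCoeff (n + 3), 0, 0, 0;
      X - 1, -verticalCoeff (n + 2), 0, 0;
      Y - 1, 0, -verticalCoeff (n + 2), 0;
      perturbationCoeff (n + 1), 1 - Z * Y, X - Z, verticalCoeff (n + 1)] _ = _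
  ext i j
  fin_cases i <;> fin_cases j <;>
    simp [verticalCoeff, perturbationCoeff, hn', Nat.even_add_one]

/-- Group homology of the trivial representation in positive degrees, from the integral matrices. -/
theorem nonempty_groupHomology_addEquiv_succ (hk : 1 ≤ k) (n : ℕ) {T : Type} [AddCommGroup T]
    (φ : (Fin (rank (n + 1)) → ℤ) →+ T)
    (surj : ∀ t, ∃ m, Matrix.vecMul m (integralBoundary k n) = 0 ∧ φ m = t)
    (hker : ∀ m, Matrix.vecMul m (integralBoundary k n) = 0 →
      (φ m = 0 ↔ ∃ a, Matrix.vecMul a (integralBoundary k (n + 1)) = m)) :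
    Nonempty (groupHomology (Rep.trivial ℤ (HeisenbergQuotient k) ℤ) (n + 1) ≃+ T) := by
  classical
  let e (n : ℕ) := Rep.coinvariantsTensorFreeEquiv ℤ (HeisenbergQuotient k) (Fin (rank n))
  have hd (n : ℕ) (x) : e n ((((resolution hk).complex.coinvariantsTensorObj
      (Rep.trivial ℤ (HeisenbergQuotient k) ℤ)).d (n + 1) n).hom x) =
        Matrix.vecMul (e (n + 1) x) (integralBoundary k n) := by
    refine Eq.trans ?_ (Rep.coinvariantsTensorFreeEquiv_map (boundary n) x)
    rw [← freeComplex_d]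
    rfl
  obtain ⟨i⟩ := HomologicalComplex.nonempty_homology_addEquiv
    ((resolution hk).complex.coinvariantsTensorObj (Rep.trivial ℤ (HeisenbergQuotient k) ℤ))
    (n + 2) (n + 1) n (by simp) (by simp) (e (n + 2)).toEquiv (e (n + 1)) (e n).toEquiv
    (map_zero (e n)) _ _ (hd (n + 1)) (hd n) φ surj hker
  exact ⟨(groupHomologyIso _ _ (resolution hk)).toLinearEquiv.toAddEquiv.trans i⟩

theorem nonempty_groupHomology_addEquiv_zero (hk : 1 ≤ k) {T : Type} [AddCommGroup T]
    (φ : (Fin 1 → ℤ) →+ T) (surj : ∀ t, ∃ m, φ m = t)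
    (hker : ∀ m, φ m = 0 ↔ ∃ a, Matrix.vecMul a (integralBoundary k 0) = m) :
    Nonempty (groupHomology (Rep.trivial ℤ (HeisenbergQuotient k) ℤ) 0 ≃+ T) := by
  classical
  let e (n : ℕ) := Rep.coinvariantsTensorFreeEquiv ℤ (HeisenbergQuotient k) (Fin (rank n))
  let K := (resolution hk).complex.coinvariantsTensorObj (Rep.trivial ℤ (HeisenbergQuotient k) ℤ)
  have hd (x) : e 0 ((K.d 1 0).hom x) = Matrix.vecMul (e 1 x) (integralBoundary k 0) := by
    refine Eq.trans ?_ (Rep.coinvariantsTensorFreeEquiv_map (boundary 0) x)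
    rw [← freeComplex_d]
    rfl
  obtain ⟨i⟩ := HomologicalComplex.nonempty_homology_addEquiv K
    -- In degree 0 the successor index defaults to 0 itself, and the differential from 0 to 0 is
    -- zero by shape.
    1 0 0 (by simp) (by simp) (e 1).toEquiv (e 0) (e 0).toEquiv
    (map_zero (e 0)) _ (fun _ => 0) hd (fun x => by rw [K.shape _ _ (by simp)]; exact map_zero (e 0)) φ
    (fun t => (surj t).imp fun m hm => ⟨rfl, hm⟩) (fun m _ => hker m)
  exact ⟨(groupHomologyIso _ _ (resolution hk)).toLinearEquiv.toAddEquiv.trans i⟩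

theorem nonempty_groupCohomology_addEquiv_succ (hk : 1 ≤ k) (n : ℕ) {T : Type} [AddCommGroup T]
    (φ : (Fin (rank (n + 1)) → ℤ) →+ T)
    (surj : ∀ t, ∃ m, Matrix.mulVec (integralBoundary k (n + 1)) m = 0 ∧ φ m = t)
    (hker : ∀ m, Matrix.mulVec (integralBoundary k (n + 1)) m = 0 →
      (φ m = 0 ↔ ∃ a, Matrix.mulVec (integralBoundary k n) a = m)) :
    Nonempty (groupCohomology (Rep.trivial ℤ (HeisenbergQuotient k) ℤ) (n + 1) ≃+ T) := by
  classical
  let e (n : ℕ) := Rep.freeHomEquiv ℤ (HeisenbergQuotient k) (Fin (rank n))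
  have hd (n : ℕ) (x) : e (n + 1) ((((resolution hk).complex.linearYonedaObj ℤ
      (Rep.trivial ℤ (HeisenbergQuotient k) ℤ)).d n (n + 1)).hom x) =
        Matrix.mulVec (integralBoundary k n) (e n x) := by
    refine Eq.trans ?_ (Rep.freeHomEquiv_comp (boundary n) x)
    rw [← freeComplex_d]
    rfl
  obtain ⟨i⟩ := HomologicalComplex.nonempty_homology_addEquiv
    ((resolution hk).complex.linearYonedaObj ℤ (Rep.trivial ℤ (HeisenbergQuotient k) ℤ))
    n (n + 1) (n + 2) (by simp) (by simp) (e n).toEquiv (e (n + 1)) (e (n + 2)).toEquiv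
    (map_zero (e (n + 2))) _ _ (hd n) (hd (n + 1)) φ surj hker
  exact ⟨(groupCohomologyIso _ _ (resolution hk)).toLinearEquiv.toAddEquiv.trans i⟩

theorem nonempty_groupCohomology_addEquiv_zero (hk : 1 ≤ k) {T : Type} [AddCommGroup T]
    (φ : (Fin 1 → ℤ) →+ T)
    (surj : ∀ t, ∃ m, Matrix.mulVec (integralBoundary k 0) m = 0 ∧ φ m = t)
    (hker : ∀ m, Matrix.mulVec (integralBoundary k 0) m = 0 → (φ m = 0 ↔ m = 0)) :
    Nonempty (groupCohomology (Rep.trivial ℤ (HeisenbergQuotient k) ℤ) 0 ≃+ T) := by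
  classical
  let e (n : ℕ) := Rep.freeHomEquiv ℤ (HeisenbergQuotient k) (Fin (rank n))
  let K := (resolution hk).complex.linearYonedaObj ℤ (Rep.trivial ℤ (HeisenbergQuotient k) ℤ)
  have hd (x) : e 1 ((K.d 0 1).hom x) = Matrix.mulVec (integralBoundary k 0) (e 0 x) := by
    refine Eq.trans ?_ (Rep.freeHomEquiv_comp (boundary 0) x)
    rw [← freeComplex_d]
    rfl
  obtain ⟨i⟩ := HomologicalComplex.nonempty_homology_addEquiv K
    -- Here the predecessor of 0 defaults to 0, so the incoming map is zero.
    0 0 1 (by simp) (by simp) (e 0).toEquiv (e 0) (e 1).toEquiv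
    (map_zero (e 1)) (fun _ => 0) _ (fun x => by rw [K.shape _ _ (by simp)]; exact map_zero (e 0)) hd φ
    surj (fun m hm => (hker m hm).trans ⟨fun h => ⟨0, h.symm⟩, fun ⟨_, h⟩ => h.symm⟩)
  exact ⟨(groupCohomologyIso _ _ (resolution hk)).toLinearEquiv.toAddEquiv.trans i⟩

end HeisenbergQuotient

/-! ### Integer linear algebra in each degree. -/

namespace HeisenbergQuotient

variable {k : ℕ}

theorem vecMul_integralBoundary_one (v : Fin 4 → ℤ) :
    Matrix.vecMul (n := Fin 3) v (integralBoundary k 1) = ![k * v 0 - v 3, 0, 0] := by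
  rw [integralBoundary_one]
  funext j
  fin_cases j <;> simp [Matrix.vecMul, dotProduct, Fin.sum_univ_succ]
  ring

theorem vecMul_integralBoundary_of_even {n : ℕ} (hn : Even n) (v : Fin 4 → ℤ) :
    Matrix.vecMul (n := Fin 4) v (integralBoundary k (n + 2)) =
      ![0, -(k * v 1), -(k * v 2), 0] := by
  rw [integralBoundary_add_two_of_even hn]
  funext j
  fin_cases j <;> simp [Matrix.vecMul, dotProduct, Fin.sum_univ_succ] <;> ring

theorem vecMul_integralBoundary_of_odd {n : ℕ} (hn : Odd n) (v : Fin 4 → ℤ) :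
    Matrix.vecMul (n := Fin 4) v (integralBoundary k (n + 2)) =
      ![k * v 0 - v 3, 0, 0, k * v 3] := by
  rw [integralBoundary_add_two_of_odd hn]
  funext j
  fin_cases j <;> simp [Matrix.vecMul, dotProduct, Fin.sum_univ_succ] <;> ring

theorem integralBoundary_one_mulVec (v : Fin 3 → ℤ) :
    Matrix.mulVec (m := Fin 4) (integralBoundary k 1) v = ![k * v 0, 0, 0, -v 0] := by
  rw [integralBoundary_one]
  funext j
  fin_cases j <;> simp [Matrix.mulVec, dotProduct, Fin.sum_univ_succ]

theorem integralBoundary_mulVec_of_even {n : ℕ} (hn : Even n) (v : Fin 4 → ℤ) :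
    Matrix.mulVec (m := Fin 4) (integralBoundary k (n + 2)) v =
      ![0, -(k * v 1), -(k * v 2), 0] := by
  rw [integralBoundary_add_two_of_even hn]
  funext j
  fin_cases j <;> simp [Matrix.mulVec, dotProduct, Fin.sum_univ_succ]

theorem integralBoundary_mulVec_of_odd {n : ℕ} (hn : Odd n) (v : Fin 4 → ℤ) :
    Matrix.mulVec (m := Fin 4) (integralBoundary k (n + 2)) v =
      ![k * v 0, 0, 0, -v 0 + k * v 3] := by
  rw [integralBoundary_add_two_of_odd hn]
  funext j
  fin_cases j <;> simp [Matrix.mulVec, dotProduct, Fin.sum_univ_succ]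

theorem vec_four_eq_iff {a b c d : ℤ} {v : Fin 4 → ℤ} :
    ![a, b, c, d] = v ↔ a = v 0 ∧ b = v 1 ∧ c = v 2 ∧ d = v 3 := by
  simp [funext_iff, Fin.forall_fin_succ]

theorem vec_three_eq_iff {a b c : ℤ} {v : Fin 3 → ℤ} :
    ![a, b, c] = v ↔ a = v 0 ∧ b = v 1 ∧ c = v 2 := by
  simp [funext_iff, Fin.forall_fin_succ]

/-- Reduction modulo `k` of the coordinates `1` and `2`. -/
def middleMod (k : ℕ) : (Fin 4 → ℤ) →+ ZMod k × ZMod k :=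
  AddMonoidHom.mk' (fun v => ((v 1 : ZMod k), (v 2 : ZMod k))) fun v w => by simp

theorem middleMod_eq_zero_iff {v : Fin 4 → ℤ} :
    middleMod k v = 0 ↔ (∃ a, v 1 = k * a) ∧ ∃ b, v 2 = k * b := by
  simp [middleMod, Prod.ext_iff, ZMod.intCast_zmod_eq_zero_iff_dvd, dvd_def]

/-- Reduction modulo `k` of the coordinates `1` and `2`, together with the coordinate `0`. -/
def middleModProd (k : ℕ) : (Fin 4 → ℤ) →+ (ZMod k × ZMod k) × ℤ :=
  (middleMod k).prod (Pi.evalAddMonoidHom _ 0)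

/-- Reduction modulo `k ^ 2` of an integral linear form in the coordinates `0` and `3`. -/
def outerMod (k : ℕ) (a b : ℤ) : (Fin 4 → ℤ) →+ ZMod (k ^ 2) :=
  AddMonoidHom.mk' (fun v => ((a * v 0 + b * v 3 : ℤ) : ZMod (k ^ 2))) fun v w => by
    simp; ring

theorem outerMod_eq_zero_iff {a b : ℤ} {v : Fin 4 → ℤ} :
    outerMod k a b v = 0 ↔ ∃ t, a * v 0 + b * v 3 = k ^ 2 * t := by
  rw [← dvd_def, ← Nat.cast_pow, ← ZMod.intCast_zmod_eq_zero_iff_dvd]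
  rfl

/-- The coordinates `1` and `2`. -/
def middle : (Fin 3 → ℤ) →+ ℤ × ℤ :=
  (Pi.evalAddMonoidHom _ 1).prod (Pi.evalAddMonoidHom _ 2)

theorem nonempty_groupHomology_zero (hk : 1 ≤ k) :
    Nonempty (groupHomology (Rep.trivial ℤ (HeisenbergQuotient k) ℤ) 0 ≃+ ℤ) := by
  refine nonempty_groupHomology_addEquiv_zero hk (Pi.evalAddMonoidHom _ 0)
    (fun t => ⟨fun _ => t, rfl⟩) fun m => ?_
  simp [integralBoundary_zero, funext_iff, Fin.forall_fin_one, eq_comm]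

theorem nonempty_groupHomology_one (hk : 1 ≤ k) :
    Nonempty (groupHomology (Rep.trivial ℤ (HeisenbergQuotient k) ℤ) 1 ≃+ ℤ × ℤ) := by
  refine nonempty_groupHomology_addEquiv_succ hk 0 middle (fun t => ⟨![0, t.1, t.2], ?_, rfl⟩)
    fun m _ => ?_
  · rw [integralBoundary_zero]
    exact Matrix.vecMul_zero _
  · constructor
    · intro h
      have h1 : m 1 = 0 := congrArg Prod.fst h
      have h2 : m 2 = 0 := congrArg Prod.snd h
      -- The perturbation entry `-1` makes the class of `z` a boundary.
      refine ⟨![0, 0, 0, -m 0], ?_⟩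
      rw [vecMul_integralBoundary_one, vec_three_eq_iff]
      simp [h1, h2]
    · rintro ⟨a, rfl⟩
      rw [vecMul_integralBoundary_one]
      rfl

theorem nonempty_groupHomology_two (hk : 1 ≤ k) :
    Nonempty (groupHomology (Rep.trivial ℤ (HeisenbergQuotient k) ℤ) 2 ≃+
      (ZMod k × ZMod k) × ℤ) := by
  refine nonempty_groupHomology_addEquiv_succ hk 1 (middleModProd k) ?_ ?_
  · rintro ⟨⟨a, b⟩, c⟩
    obtain ⟨a, rfl⟩ := ZMod.intCast_surjective a
    obtain ⟨b, rfl⟩ := ZMod.intCast_surjective b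
    -- Cycles satisfy `m 3 = k * m 0`, so coordinate 0 is free and supplies the summand `ℤ`.
    refine ⟨![c, a, b, k * c], ?_, rfl⟩
    rw [vecMul_integralBoundary_one]
    simp
  · intro m hm
    rw [vecMul_integralBoundary_one] at hm
    have hm0 : k * m 0 - m 3 = 0 := congrFun hm 0
    have hz : middleModProd k m = 0 ↔ middleMod k m = 0 ∧ m 0 = 0 := Prod.ext_iff
    rw [hz, middleMod_eq_zero_iff]
    constructor
    · rintro ⟨⟨⟨a, ha⟩, b, hb⟩, h0⟩
      refine ⟨![0, -a, -b, 0], ?_⟩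
      rw [vecMul_integralBoundary_of_even (n := 0) Even.zero, vec_four_eq_iff]
      refine ⟨h0.symm, by simp [ha], by simp [hb], ?_⟩
      rw [h0] at hm0
      linarith
    · rintro ⟨a, rfl⟩
      rw [vecMul_integralBoundary_of_even (n := 0) Even.zero]
      exact ⟨⟨⟨-a 1, by simp⟩, -a 2, by simp⟩, rfl⟩

/-- Boundaries have outer coordinates `(k * a 0 - a 3, k * a 3)`. The form `k * m 0 + m 3`
eliminates `a 3` and leaves `k ^ 2 * a 0`, hence a cyclic quotient. -/
theorem nonempty_groupHomology_of_odd (hk : 1 ≤ k) {n : ℕ} (hn : Even n) :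
    Nonempty (groupHomology (Rep.trivial ℤ (HeisenbergQuotient k) ℤ) (n + 3) ≃+
      ZMod (k ^ 2)) := by
  have hk0 : k ≠ 0 := by omega
  refine nonempty_groupHomology_addEquiv_succ hk (n + 2) (outerMod k k 1) ?_ ?_
  · intro t
    obtain ⟨t, rfl⟩ := ZMod.intCast_surjective t
    refine ⟨![0, 0, 0, t], ?_, ?_⟩
    · rw [vecMul_integralBoundary_of_even hn]
      simp
    · change ((k * 0 + 1 * t : ℤ) : ZMod (k ^ 2)) = _
      simp
  · intro m hm
    rw [vecMul_integralBoundary_of_even hn] at hm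
    have hm1 : m 1 = 0 := by simpa [hk0] using congrFun hm 1
    have hm2 : m 2 = 0 := by simpa [hk0] using congrFun hm 2
    rw [outerMod_eq_zero_iff]
    constructor
    · rintro ⟨t, ht⟩
      refine ⟨![t, 0, 0, k * t - m 0], ?_⟩
      rw [vecMul_integralBoundary_of_odd hn.add_one, vec_four_eq_iff]
      refine ⟨by simp, hm1.symm, hm2.symm, ?_⟩
      simp
      linear_combination -ht
    · rintro ⟨a, rfl⟩
      rw [vecMul_integralBoundary_of_odd hn.add_one]
      refine ⟨a 0, ?_⟩
      simp
      ring

theorem nonempty_groupHomology_of_even (hk : 1 ≤ k) {n : ℕ} (hn : Odd n) :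
    Nonempty (groupHomology (Rep.trivial ℤ (HeisenbergQuotient k) ℤ) (n + 3) ≃+
      ZMod k × ZMod k) := by
  have hk0 : k ≠ 0 := by omega
  refine nonempty_groupHomology_addEquiv_succ hk (n + 2) (middleMod k) ?_ ?_
  · rintro ⟨a, b⟩
    obtain ⟨a, rfl⟩ := ZMod.intCast_surjective a
    obtain ⟨b, rfl⟩ := ZMod.intCast_surjective b
    refine ⟨![0, a, b, 0], ?_, rfl⟩
    rw [vecMul_integralBoundary_of_odd hn]
    simp
  · intro m hm
    rw [vecMul_integralBoundary_of_odd hn] at hm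
    have hm3 : m 3 = 0 := by simpa [hk0] using congrFun hm 3
    have hm0 : m 0 = 0 := by simpa [hk0, hm3] using congrFun hm 0
    rw [middleMod_eq_zero_iff]
    constructor
    · rintro ⟨⟨a, ha⟩, b, hb⟩
      refine ⟨![0, -a, -b, 0], ?_⟩
      rw [vecMul_integralBoundary_of_even hn.add_one, vec_four_eq_iff]
      exact ⟨hm0.symm, by simp [ha], by simp [hb], hm3.symm⟩
    · rintro ⟨a, rfl⟩
      rw [vecMul_integralBoundary_of_even hn.add_one]
      exact ⟨⟨-a 1, by simp⟩, -a 2, by simp⟩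

theorem nonempty_groupCohomology_zero (hk : 1 ≤ k) :
    Nonempty (groupCohomology (Rep.trivial ℤ (HeisenbergQuotient k) ℤ) 0 ≃+ ℤ) := by
  refine nonempty_groupCohomology_addEquiv_zero hk (Pi.evalAddMonoidHom _ 0)
    (fun t => ⟨fun _ => t, ?_, rfl⟩) fun m _ => ?_
  · rw [integralBoundary_zero]
    exact Matrix.zero_mulVec _
  · simp [funext_iff, Fin.forall_fin_one]

theorem nonempty_groupCohomology_one (hk : 1 ≤ k) :
    Nonempty (groupCohomology (Rep.trivial ℤ (HeisenbergQuotient k) ℤ) 1 ≃+ ℤ × ℤ) := by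
  refine nonempty_groupCohomology_addEquiv_succ hk 0 middle (fun t => ⟨![0, t.1, t.2], ?_, rfl⟩)
    fun m hm => ?_
  · rw [integralBoundary_one_mulVec]
    simp
  · rw [integralBoundary_one_mulVec] at hm
    have hm0 : m 0 = 0 := by simpa using congrFun hm 3
    rw [integralBoundary_zero]
    constructor
    · intro h
      refine ⟨0, ?_⟩
      rw [Matrix.zero_mulVec]
      funext j
      fin_cases j
      exacts [hm0.symm, (congrArg Prod.fst h).symm, (congrArg Prod.snd h).symm]
    · rintro ⟨a, rfl⟩
      rw [Matrix.zero_mulVec, map_zero]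

theorem nonempty_groupCohomology_two (hk : 1 ≤ k) :
    Nonempty (groupCohomology (Rep.trivial ℤ (HeisenbergQuotient k) ℤ) 2 ≃+ ℤ) := by
  have hk0 : k ≠ 0 := by omega
  -- Coboundaries are the multiples of `(k, 0, 0, -1)`, the kernel of this form on the outer
  -- coordinates.
  let φ : (Fin 4 → ℤ) →+ ℤ :=
    AddMonoidHom.mk' (fun v => v 0 + k * v 3) fun v w => by simp; ring
  have hφ (v : Fin 4 → ℤ) : φ v = v 0 + k * v 3 := rfl
  refine nonempty_groupCohomology_addEquiv_succ hk 1 φ (fun t => ⟨![t, 0, 0, 0], ?_, ?_⟩)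
    fun m hm => ?_
  · rw [integralBoundary_mulVec_of_even (n := 0) Even.zero]
    simp
  · rw [hφ]
    simp
  · rw [integralBoundary_mulVec_of_even (n := 0) Even.zero] at hm
    have hm1 : m 1 = 0 := by simpa [hk0] using congrFun hm 1
    have hm2 : m 2 = 0 := by simpa [hk0] using congrFun hm 2
    rw [hφ]
    constructor
    · intro h
      refine ⟨![-m 3, 0, 0], ?_⟩
      rw [integralBoundary_one_mulVec, vec_four_eq_iff]
      refine ⟨?_, hm1.symm, hm2.symm, by simp⟩
      simp
      linear_combination -h
    · rintro ⟨a, rfl⟩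
      rw [integralBoundary_one_mulVec]
      simp

theorem nonempty_groupCohomology_of_odd (hk : 1 ≤ k) {n : ℕ} (hn : Even n) :
    Nonempty (groupCohomology (Rep.trivial ℤ (HeisenbergQuotient k) ℤ) (n + 3) ≃+
      ZMod k × ZMod k) := by
  have hk0 : k ≠ 0 := by omega
  refine nonempty_groupCohomology_addEquiv_succ hk (n + 2) (middleMod k) ?_ ?_
  · rintro ⟨a, b⟩
    obtain ⟨a, rfl⟩ := ZMod.intCast_surjective a
    obtain ⟨b, rfl⟩ := ZMod.intCast_surjective b
    refine ⟨![0, a, b, 0], ?_, rfl⟩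
    rw [integralBoundary_mulVec_of_odd hn.add_one]
    simp
  · intro m hm
    rw [integralBoundary_mulVec_of_odd hn.add_one] at hm
    have hm0 : m 0 = 0 := by simpa [hk0] using congrFun hm 0
    have hm3 : m 3 = 0 := by simpa [hk0, hm0] using congrFun hm 3
    rw [middleMod_eq_zero_iff]
    constructor
    · rintro ⟨⟨a, ha⟩, b, hb⟩
      refine ⟨![0, -a, -b, 0], ?_⟩
      rw [integralBoundary_mulVec_of_even hn, vec_four_eq_iff]
      exact ⟨hm0.symm, by simp [ha], by simp [hb], hm3.symm⟩
    · rintro ⟨a, rfl⟩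
      rw [integralBoundary_mulVec_of_even hn]
      exact ⟨⟨-a 1, by simp⟩, -a 2, by simp⟩

/-- For the transposed block, coboundaries are `(k * a 0, -a 0 + k * a 3)`, and `m 0 + k * m 3`
takes the value `k ^ 2 * a 3` on them. -/
theorem nonempty_groupCohomology_of_even (hk : 1 ≤ k) {n : ℕ} (hn : Odd n) :
    Nonempty (groupCohomology (Rep.trivial ℤ (HeisenbergQuotient k) ℤ) (n + 3) ≃+
      ZMod (k ^ 2)) := by
  have hk0 : k ≠ 0 := by omega
  refine nonempty_groupCohomology_addEquiv_succ hk (n + 2) (outerMod k 1 k) ?_ ?_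
  · intro t
    obtain ⟨t, rfl⟩ := ZMod.intCast_surjective t
    refine ⟨![t, 0, 0, 0], ?_, ?_⟩
    · rw [integralBoundary_mulVec_of_even hn.add_one]
      simp
    · change ((1 * t + k * 0 : ℤ) : ZMod (k ^ 2)) = _
      simp
  · intro m hm
    rw [integralBoundary_mulVec_of_even hn.add_one] at hm
    have hm1 : m 1 = 0 := by simpa [hk0] using congrFun hm 1
    have hm2 : m 2 = 0 := by simpa [hk0] using congrFun hm 2
    rw [outerMod_eq_zero_iff]
    constructor
    · rintro ⟨t, ht⟩
      refine ⟨![k * t - m 3, 0, 0, t], ?_⟩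
      rw [integralBoundary_mulVec_of_odd hn, vec_four_eq_iff]
      refine ⟨?_, hm1.symm, hm2.symm, by simp⟩
      simp
      linear_combination -ht
    · rintro ⟨a, rfl⟩
      rw [integralBoundary_mulVec_of_odd hn]
      refine ⟨a 3, ?_⟩
      simp
      ring

end HeisenbergQuotient

theorem mainTheorem6 (k : ℕ) (hk : 1 ≤ k) :
    (Nonempty (groupHomology (Rep.trivial ℤ (HeisenbergQuotient k) ℤ) 0 ≃+ ℤ) ∧
      Nonempty (groupHomology (Rep.trivial ℤ (HeisenbergQuotient k) ℤ) 1 ≃+ ℤ × ℤ) ∧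
      Nonempty (groupHomology (Rep.trivial ℤ (HeisenbergQuotient k) ℤ) 2 ≃+
        (ZMod k × ZMod k) × ℤ) ∧
      (∀ i : ℕ, 1 < i → Odd i →
        Nonempty (groupHomology (Rep.trivial ℤ (HeisenbergQuotient k) ℤ) i ≃+ ZMod (k ^ 2))) ∧
      (∀ i : ℕ, 2 < i → Even i →
        Nonempty (groupHomology (Rep.trivial ℤ (HeisenbergQuotient k) ℤ) i ≃+
          ZMod k × ZMod k))) ∧
    (Nonempty (groupCohomology (Rep.trivial ℤ (HeisenbergQuotient k) ℤ) 0 ≃+ ℤ) ∧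
      Nonempty (groupCohomology (Rep.trivial ℤ (HeisenbergQuotient k) ℤ) 1 ≃+ ℤ × ℤ) ∧
      Nonempty (groupCohomology (Rep.trivial ℤ (HeisenbergQuotient k) ℤ) 2 ≃+ ℤ) ∧
      (∀ i : ℕ, 1 < i → Odd i →
        Nonempty (groupCohomology (Rep.trivial ℤ (HeisenbergQuotient k) ℤ) i ≃+
          ZMod k × ZMod k)) ∧
      (∀ i : ℕ, 2 < i → Even i →
        Nonempty (groupCohomology (Rep.trivial ℤ (HeisenbergQuotient k) ℤ) i ≃+
          ZMod (k ^ 2)))) := by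
  open HeisenbergQuotient in
  refine ⟨⟨nonempty_groupHomology_zero hk, nonempty_groupHomology_one hk,
    nonempty_groupHomology_two hk, fun i hi hodd => ?_, fun i hi heven => ?_⟩,
    nonempty_groupCohomology_zero hk, nonempty_groupCohomology_one hk,
    nonempty_groupCohomology_two hk, fun i hi hodd => ?_, fun i hi heven => ?_⟩
  -- An odd `i > 1` is at least 3; the shift by 3 reverses parity.
  · obtain ⟨n, rfl⟩ : ∃ n, i = n + 3 := ⟨i - 3, by have := hodd; grind⟩
    exact HeisenbergQuotient.nonempty_groupHomology_of_odd hk (by grind)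
  · obtain ⟨n, rfl⟩ : ∃ n, i = n + 3 := ⟨i - 3, by omega⟩
    exact HeisenbergQuotient.nonempty_groupHomology_of_even hk (by grind)
  · obtain ⟨n, rfl⟩ : ∃ n, i = n + 3 := ⟨i - 3, by have := hodd; grind⟩
    exact HeisenbergQuotient.nonempty_groupCohomology_of_odd hk (by grind)
  · obtain ⟨n, rfl⟩ : ∃ n, i = n + 3 := ⟨i - 3, by omega⟩
    exact HeisenbergQuotient.nonempty_groupCohomology_of_even hk (by grind)
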